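/- Let $\Gamma=\mathbb Z^2\rtimes SL(2,\mathbb Z)$ act on $\mathbb Z^2$ by $(k,\gamma)\cdot m=k+\gamma m$, and put $\det(k,m)=k_1m_2-k_2m_1$ for $k,m\in\mathbb Z^2$. Let $\Lambda$ be the abelian group of finitely supported functions $\lambda:\mathbb Z^2\to\mathbb Z$ with $\sum_m\lambda(m)=0$, on which $\Gamma$ acts by $(g\cdot\lambda)(m)=\lambda(g^{-1}\cdot m)$. Let $N=N(\mathbb Z,1)$ be the group von Neumann algebra of $\Lambda$, that is, the double commutant of $\{u(\lambda)\mid\lambda\in\Lambda\}$ in $B(\ell^2\Lambda)$, where $u(\lambda)\delta_\sigma=\delta_{\lambda+\sigma}$; let $\mathrm{tr}(a)=\langle a\delta_0,\delta_0\rangle$ be its trace. For $c\in\mathbb T$ let $\chi_c$ be the character $\chi_c(n)=c^n$ of $\mathbb Z$. The twisted Bernoulli shift action $\beta(\mathbb Z,1,\chi_c)$ is the action of $\Gamma$ on $N$ by normal $*$-automorphisms with $$\beta(k,\gamma)(u(\lambda))=\Big(\prod_{m\in\mathbb Z^2}\chi_c\big((\gamma\cdot\lambda)(m)\big)^{\det(k,m)}\Big)\,u\big((k,\gamma)\cdot\lambda\big),\qquad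 (k,\gamma)\in\Gamma,\ \lambda\in\Lambda.$$ Then there are a standard Borel space $X$ with a non-atomic probability measure $\nu$ and a $*$-isomorphism $\Phi:N\to L^\infty(X,\nu)$ with $\mathrm{tr}(a)=\int_X\Phi(a)\,d\nu$ for all $a\in N$, such that, for the actions $\beta_c(g)=\Phi\circ\beta(\mathbb Z,1,\chi_c)(g)\circ\Phi^{-1}$ of $\Gamma$ on $L^\infty(X,\nu)$ and the set $C=\{e^{i\pi t}\mid 0<t<1/2\}$ of parameters, the following hold. 1. The set $C$ has the cardinality of the continuum. 2. For every $c\in C$ the action $\beta_c$ preserves the trace $f\mapsto\int_X f\,d\nu$; it is essentially free (it is induced by an action of $\Gamma$ on $X$ by $\nu$-preserving Borel isomorphisms for which every $g\ne1$ has a $\nu$-null set of fixed points); it is ergodic (every $\beta_c$-invariant element of $L^\infty(X,\nu)$ is a scalar multiple of $1$); and its centralizer is trivial: the identity is the only $*$-automorphism $\alpha$ of $L^\infty(X,\nu)$ with $\alpha\circ\beta_c(g)=\beta_c(g)\circ\alpha$ for all $g\in\Gamma$. 3. If $c,d\in C$ and $c\ne d$, then $\beta_c$ and $\beta_d$ are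 not conjugate: there is no $*$-automorphism $\pi$ of $L^\infty(X,\nu)$, trace preserving or not, with $\pi\circ\beta_c(g)=\beta_d(g)\circ\pi$ for all $g\in\Gamma$. -/

import Mathlib

open scoped ENNReal InnerProductSpace
open MeasureTheory

noncomputable section

namespace TwistedBernoulli

/-! ### The group `ℤ² ⋊ SL(2,ℤ)` and its action on `ℤ²` -/

/-- The lattice `ℤ²`. -/
abbrev Z2 := Fin 2 → ℤ

/-- The group `SL(2,ℤ)`. -/
abbrev SL2Z := Matrix.SpecialLinearGroup (Fin 2) ℤ

/-- The action of `SL(2,ℤ)` on `ℤ²` by matrix multiplication. -/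
def slAut : SL2Z →* MulAut (Multiplicative Z2) :=
  MonoidHom.mk'
    (fun γ =>
      AddEquiv.toMultiplicative
        { toFun := fun k => Matrix.mulVec γ k
          invFun := fun k => Matrix.mulVec (γ⁻¹ : SL2Z) k
          left_inv := fun k => by
            change Matrix.mulVec (γ⁻¹ : SL2Z) (Matrix.mulVec (γ : Matrix (Fin 2) (Fin 2) ℤ) k) = k
            rw [Matrix.mulVec_mulVec, ← Matrix.SpecialLinearGroup.coe_mul]; simp
          right_inv := fun k => by
            change Matrix.mulVec γ (Matrix.mulVec ((γ⁻¹ : SL2Z) : Matrix (Fin 2) (Fin 2) ℤ) k) = k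
            rw [Matrix.mulVec_mulVec, ← Matrix.SpecialLinearGroup.coe_mul]; simp
          map_add' := fun k l => Matrix.mulVec_add _ k l })
    (fun γ δ => by
      ext k : 1
      change Multiplicative.ofAdd (Matrix.mulVec (γ * δ : SL2Z) k.toAdd) =
        Multiplicative.ofAdd
          (Matrix.mulVec (γ : Matrix (Fin 2) (Fin 2) ℤ)
            (Matrix.mulVec (δ : Matrix (Fin 2) (Fin 2) ℤ) k.toAdd))
      rw [Matrix.mulVec_mulVec, ← Matrix.SpecialLinearGroup.coe_mul])

/-- The group `ℤ² ⋊ SL(2,ℤ)`. -/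
abbrev Gam := Multiplicative Z2 ⋊[slAut] SL2Z

/-- The affine action `(k, γ) · m = k + γ m` of `ℤ² ⋊ SL(2,ℤ)` on `ℤ²`. -/
instance instActionZ2 : MulAction Gam Z2 where
  smul g m := g.left.toAdd + Matrix.mulVec g.right m
  one_smul m := by
    change (0 : Z2) + Matrix.mulVec (1 : Matrix (Fin 2) (Fin 2) ℤ) m = m
    simp
  mul_smul g h m := by
    change (g.left.toAdd + Matrix.mulVec g.right h.left.toAdd) +
        Matrix.mulVec (g.right * h.right : SL2Z) m =
      g.left.toAdd + Matrix.mulVec g.right (h.left.toAdd + Matrix.mulVec h.right m)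
    rw [Matrix.mulVec_add, Matrix.mulVec_mulVec, Matrix.SpecialLinearGroup.coe_mul, add_assoc]

theorem smul_def (g : Gam) (m : Z2) :
    g • m = g.left.toAdd + Matrix.mulVec g.right m := rfl

/-- `det((q, r), (q₀, r₀)) = q r₀ - r q₀`. -/
def det2 (k l : Z2) : ℤ := k 0 * l 1 - k 1 * l 0

/-! ### Scalar 2-cocycles and the group `Λ(H)` -/

/-- A normalized scalar 2-cocycle of an abelian group `H`. -/
structure NormalizedCocycle (H : Type*) [AddCommGroup H] where
  /-- The underlying circle-valued function. -/
  toFun : H → H → Circle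
  map_zero_left : ∀ h, toFun 0 h = 1
  map_zero_right : ∀ h, toFun h 0 = 1
  cocycle : ∀ g h k, toFun g h * toFun (g + h) k = toFun h k * toFun g (h + k)

/-- The trivial cocycle. -/
instance instOneCocycle (H : Type*) [AddCommGroup H] : One (NormalizedCocycle H) :=
  ⟨⟨fun _ _ => 1, fun _ => rfl, fun _ => rfl, fun _ _ _ => rfl⟩⟩

variable {H : Type*} [AddCommGroup H]

variable (H) in
/-- The finitely supported functions `λ : ℤ² → H` with `∑ₖ λ(k) = 0`. -/
def Lam : AddSubgroup (Z2 →₀ H) :=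
  (Finsupp.liftAddHom fun _ : Z2 => AddMonoidHom.id H).ker

/-- The action `(g · λ)(k) = λ(g⁻¹ · k)` of `ℤ² ⋊ SL(2,ℤ)` on `Λ(H)`. -/
instance instActionLam : MulAction Gam (Lam H) where
  smul g l := ⟨Finsupp.equivMapDomain (MulAction.toPerm g) l.1, by
    have h := l.2
    simp only [Lam, AddMonoidHom.mem_ker, Finsupp.liftAddHom_apply] at h ⊢
    rw [Finsupp.sum_equivMapDomain]
    exact h⟩
  one_smul l := by
    apply Subtype.ext; ext k
    change l.1 ((1 : Gam)⁻¹ • k) = l.1 k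
    simp
  mul_smul g h l := by
    apply Subtype.ext; ext k
    change l.1 ((g * h)⁻¹ • k) = l.1 (h⁻¹ • g⁻¹ • k)
    rw [mul_inv_rev, mul_smul]

theorem lam_smul_apply (g : Gam) (l : Lam H) (k : Z2) : (g • l).1 k = l.1 (g⁻¹ • k) := rfl

theorem lam_smul_add (g : Gam) (l l' : Lam H) : g • (l + l') = g • l + g • l' := by
  apply Subtype.ext; ext k; rfl

/-- The cocycle `μ̃(λ₁, λ₂) = ∏ₖ μ(λ₁(k), λ₂(k))` on `Λ(H)`; all but finitely many factors
are `1`. -/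
def tildeCocycle (μ : NormalizedCocycle H) (l l' : Lam H) : Circle :=
  ∏ᶠ k : Z2, μ.toFun (l.1 k) (l'.1 k)

theorem tildeCocycle_smul (μ : NormalizedCocycle H) (g : Gam) (l l' : Lam H) :
    tildeCocycle μ (g • l) (g • l') = tildeCocycle μ l l' :=
  finprod_comp_equiv (MulAction.toPerm g⁻¹) (f := fun k => μ.toFun (l.1 k) (l'.1 k))

/-! ### Double commutants and actions by conjugation -/

section DoubleCommutant

variable {R : Type*} [Ring R] [StarRing R] [Algebra ℂ R] [StarModule ℂ R]

/-- The double commutant of `S ∪ S*`. -/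
def doubleCommutant (S : Set R) : StarSubalgebra ℂ R :=
  StarSubalgebra.centralizer ℂ (StarSubalgebra.centralizer ℂ S : Set R)

theorem centralizer_doubleCommutant (S : Set R) :
    Set.centralizer (Set.centralizer (doubleCommutant S : Set R)) = (doubleCommutant S : Set R) := by
  unfold doubleCommutant
  rw [StarSubalgebra.coe_centralizer_centralizer, Set.centralizer_centralizer_centralizer]

theorem subset_doubleCommutant (S : Set R) : S ⊆ (doubleCommutant S : Set R) := by
  unfold doubleCommutant
  rw [StarSubalgebra.coe_centralizer_centralizer]
  exact fun s hs => Set.subset_centralizer_centralizer (Or.inl hs)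

theorem map_mem_commutant {S : Set R} (θ : R ≃⋆ₐ[ℂ] R)
    (hθ : ∀ s ∈ S, ∃ t ∈ S, ∃ z : ℂ, z ≠ 0 ∧ θ t = z • s) {b : R}
    (hb : b ∈ StarSubalgebra.centralizer ℂ S) : θ b ∈ StarSubalgebra.centralizer ℂ S := by
  rw [StarSubalgebra.mem_centralizer_iff] at hb ⊢
  intro s hs
  obtain ⟨t, ht, z, hz, h⟩ := hθ s hs
  have hu : s = θ (z⁻¹ • t) := by rw [map_smul, h, smul_smul, inv_mul_cancel₀ hz, one_smul]
  obtain ⟨h1, h2⟩ := hb t ht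
  rw [hu, ← map_star, star_smul, ← map_mul, ← map_mul, ← map_mul, ← map_mul, smul_mul_assoc,
    smul_mul_assoc, mul_smul_comm, mul_smul_comm, h1, h2]
  exact ⟨rfl, rfl⟩

theorem map_mem_doubleCommutant {S : Set R} (θ : R ≃⋆ₐ[ℂ] R)
    (hθ : ∀ s ∈ S, ∃ t ∈ S, ∃ z : ℂ, z ≠ 0 ∧ θ.symm t = z • s) {a : R}
    (ha : a ∈ doubleCommutant S) : θ a ∈ doubleCommutant S := by
  unfold doubleCommutant at *
  rw [StarSubalgebra.mem_centralizer_iff] at ha ⊢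
  intro b hb
  have hb' := map_mem_commutant θ.symm hθ hb
  obtain ⟨h1, h2⟩ := ha _ hb'
  have hbe : b = θ (θ.symm b) := (θ.apply_symm_apply b).symm
  rw [hbe, ← map_star, ← map_mul, ← map_mul, ← map_mul, ← map_mul, h1, h2]
  exact ⟨rfl, rfl⟩

/-- The action `g ↦ (a ↦ V(g) a V(g)*)` on the double commutant of `S ∪ S*`, for a unitary
representation `V` that permutes `S` up to scalars. -/
def conjAction {G : Type*} [Group G] (S : Set R) (V : G →* unitary R)
    (hV : ∀ g, ∀ s ∈ S, ∃ t ∈ S, ∃ z : ℂ, z ≠ 0 ∧ Unitary.conjStarAlgAut ℂ R (V g) t = z • s) :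
    G →* (doubleCommutant S ≃⋆ₐ[ℂ] doubleCommutant S) :=
  have hmem : ∀ g, ∀ a ∈ doubleCommutant S,
      Unitary.conjStarAlgAut ℂ R (V g) a ∈ doubleCommutant S := fun g a ha =>
    map_mem_doubleCommutant _ (by
      rw [← StarAlgEquiv.aut_inv, ← map_inv, ← map_inv]; exact hV g⁻¹) ha
  have hcancel : ∀ g h : G, g * h = 1 → ∀ a : R,
      Unitary.conjStarAlgAut ℂ R (V g) (Unitary.conjStarAlgAut ℂ R (V h) a) = a := fun g h e a => by
    rw [← StarAlgEquiv.mul_apply, ← map_mul, ← map_mul, e, map_one, map_one,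
      StarAlgEquiv.one_apply]
  MonoidHom.mk'
    (fun g =>
      { toFun := fun a => ⟨Unitary.conjStarAlgAut ℂ R (V g) a.1, hmem g a.1 a.2⟩
        invFun := fun a => ⟨Unitary.conjStarAlgAut ℂ R (V g⁻¹) a.1, hmem g⁻¹ a.1 a.2⟩
        left_inv := fun a => Subtype.ext (hcancel _ _ (inv_mul_cancel g) a.1)
        right_inv := fun a => Subtype.ext (hcancel _ _ (mul_inv_cancel g) a.1)
        map_mul' := fun a b => Subtype.ext (map_mul _ a.1 b.1)
        map_add' := fun a b => Subtype.ext (map_add _ a.1 b.1)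
        map_star' := fun a => Subtype.ext (map_star _ a.1)
        map_smul' := fun c a => Subtype.ext (map_smul _ c a.1) })
    (fun g h => by
      ext a : 1
      apply Subtype.ext
      change Unitary.conjStarAlgAut ℂ R (V (g * h)) a.1 =
        Unitary.conjStarAlgAut ℂ R (V g) (Unitary.conjStarAlgAut ℂ R (V h) a.1)
      rw [map_mul, map_mul, StarAlgEquiv.mul_apply])

end DoubleCommutant

/-! ### Weighted permutation unitaries on `ℓ²` -/

/-- The Hilbert space `ℓ²(ι)`. -/
abbrev EllTwo (ι : Type*) := lp (fun _ : ι => ℂ) 2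

/-- The vector `δᵢ` of the standard orthonormal basis. -/
def basisVec {ι : Type*} (i : ι) : EllTwo ι :=
  haveI := Classical.decEq ι
  lp.single 2 i (1 : ℂ)

theorem basisVec_apply {ι : Type*} (i j : ι) [Decidable (j = i)] :
    (basisVec i : EllTwo ι) j = if j = i then 1 else 0 := by
  classical
  unfold basisVec
  rw [lp.single_apply, Pi.single_apply]
  congr

theorem memlp_weighted {ι : Type*} (e : ι ≃ ι) (w : ι → Circle) (f : EllTwo ι) :
    Memℓp (fun j => (w j : ℂ) * f (e j)) (2 : ℝ≥0∞) := by
  have h2 : 0 < (2 : ℝ≥0∞).toReal := by simp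
  rw [memℓp_gen_iff h2]
  have h := (memℓp_gen_iff h2).1 (lp.memℓp f)
  simpa [Function.comp_def, Circle.norm_coe, -Circle.coe_inv] using (e.summable_iff).2 h

/-- The map `f ↦ (j ↦ w(e⁻¹ j) f(e⁻¹ j))` on `ℓ²(ι)`, that is, `δᵢ ↦ w(i) δ_{e(i)}`. -/
def weightedIso {ι : Type*} (e : ι ≃ ι) (w : ι → Circle) : EllTwo ι ≃ₗᵢ[ℂ] EllTwo ι where
  toFun f := ⟨fun j => (w (e.symm j) : ℂ) * f (e.symm j),
    memlp_weighted e.symm (fun j => w (e.symm j)) f⟩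
  invFun f := ⟨fun j => ((w j)⁻¹ : Circle) * f (e j), memlp_weighted e (fun j => (w j)⁻¹) f⟩
  left_inv f := by
    ext j
    simp
  right_inv f := by
    ext j
    simp
  map_add' f g := by
    ext j
    exact mul_add _ _ _
  map_smul' c f := by
    ext j
    exact mul_left_comm _ _ _
  norm_map' f := by
    have h2 : 0 < (2 : ℝ≥0∞).toReal := by simp
    rw [lp.norm_eq_tsum_rpow h2, lp.norm_eq_tsum_rpow h2]
    congr 1
    rw [← e.symm.tsum_eq (fun j => ‖f j‖ ^ (2 : ℝ≥0∞).toReal)]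
    refine tsum_congr fun j => ?_
    change ‖(w (e.symm j) : ℂ) * f (e.symm j)‖ ^ _ = _
    rw [norm_mul, Circle.norm_coe, one_mul]

/-- `weightedIso` as a unitary element of `B(ℓ²(ι))`. -/
def weightedUnitary {ι : Type*} (e : ι ≃ ι) (w : ι → Circle) :
    unitary (EllTwo ι →L[ℂ] EllTwo ι) :=
  Unitary.linearIsometryEquiv.symm (weightedIso e w)

theorem weightedUnitary_apply {ι : Type*} (e : ι ≃ ι) (w : ι → Circle) (f : EllTwo ι) (j : ι) :
    ((weightedUnitary e w : EllTwo ι →L[ℂ] EllTwo ι) f : EllTwo ι) j =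
      (w (e.symm j) : ℂ) * f (e.symm j) := rfl

/-! ### The twisted group von Neumann algebra `N(H, μ) = L_μ̃(Λ(H))` -/

/-- The unitary `u(λ)` on `ℓ²(Λ(H))` with `u(λ) δ_σ = μ̃(λ, σ) δ_{λ + σ}`. -/
def u (μ : NormalizedCocycle H) (l : Lam H) : unitary (EllTwo (Lam H) →L[ℂ] EllTwo (Lam H)) :=
  weightedUnitary (Equiv.addLeft l) (tildeCocycle μ l)

/-- The set `{u(λ) | λ ∈ Λ(H)}`. -/
def generators (μ : NormalizedCocycle H) : Set (EllTwo (Lam H) →L[ℂ] EllTwo (Lam H)) :=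
  Set.range fun l => (u μ l : EllTwo (Lam H) →L[ℂ] EllTwo (Lam H))

/-- The von Neumann algebra `N(H, μ)`: the double commutant of `{u(λ) | λ ∈ Λ(H)}`. -/
def N (μ : NormalizedCocycle H) : VonNeumannAlgebra (EllTwo (Lam H)) where
  toStarSubalgebra := doubleCommutant (generators μ)
  centralizer_centralizer' := centralizer_doubleCommutant (generators μ)

/-- The elements of `N(H, μ)`, as a `*`-algebra. -/
abbrev NAlg (μ : NormalizedCocycle H) := (N μ).toStarSubalgebra

/-- The trace `tr(a) = ⟨a δ₀, δ₀⟩` (linear in `a`) of `N(H, μ)`. -/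
def trace (μ : NormalizedCocycle H) (a : NAlg μ) : ℂ :=
  ⟪basisVec (0 : Lam H), (a : EllTwo (Lam H) →L[ℂ] EllTwo (Lam H)) (basisVec 0)⟫_ℂ

theorem u_mem (μ : NormalizedCocycle H) (l : Lam H) :
    (u μ l : EllTwo (Lam H) →L[ℂ] EllTwo (Lam H)) ∈ (N μ).toStarSubalgebra :=
  subset_doubleCommutant (generators μ) ⟨l, rfl⟩

/-! ### The twisted Bernoulli shift action -/

/-- The scalar `∏ₘ χ((γ · λ)(m)) ^ det(k, m)` attached to `g = (k, γ)`; all but finitely many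
factors are `1`. -/
def twist (χ : AddChar H Circle) (g : Gam) (l : Lam H) : Circle :=
  ∏ᶠ m : Z2, χ (((SemidirectProduct.inr g.right : Gam) • l).1 m) ^ det2 g.left.toAdd m

theorem hasFiniteMulSupport_twist (χ : AddChar H Circle) (l : Lam H) (d : Z2 → ℤ) :
    (Function.mulSupport fun m => χ (l.1 m) ^ d m).Finite := by
  refine l.1.support.finite_toSet.subset fun m hm => ?_
  simp only [Function.mem_mulSupport] at hm
  simp only [Finset.mem_coe, Finsupp.mem_support_iff]
  intro h0
  exact hm (by simp [h0])

theorem det2_mulVec (γ : SL2Z) (k l : Z2) :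
    det2 (Matrix.mulVec γ k) (Matrix.mulVec γ l) = det2 k l := by
  have h := γ.det_coe
  rw [Matrix.det_fin_two] at h
  simp only [det2, Matrix.mulVec, dotProduct, Fin.sum_univ_two]
  linear_combination (k 0 * l 1 - k 1 * l 0) * h

/-- The product over the values of `λ`, written before applying `γ`. -/
theorem twist_eq (χ : AddChar H Circle) (g : Gam) (l : Lam H) :
    twist χ g l = ∏ᶠ m : Z2, χ (l.1 m) ^ det2 g.left.toAdd (Matrix.mulVec g.right m) := by
  unfold twist
  rw [← finprod_comp_equiv (MulAction.toPerm (SemidirectProduct.inr g.right : Gam))]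
  refine finprod_congr fun m => ?_
  rw [lam_smul_apply, MulAction.toPerm_apply, inv_smul_smul]
  congr 2
  rw [smul_def]
  simp

theorem twist_add (χ : AddChar H Circle) (g : Gam) (l l' : Lam H) :
    twist χ g (l + l') = twist χ g l * twist χ g l' := by
  rw [twist_eq, twist_eq, twist_eq,
    ← finprod_mul_distrib (hasFiniteMulSupport_twist χ l _) (hasFiniteMulSupport_twist χ l' _)]
  refine finprod_congr fun m => ?_
  change χ (l.1 m + l'.1 m) ^ _ = _
  rw [AddChar.map_add_eq_mul, mul_zpow]

theorem prod_char_eq_one (χ : AddChar H Circle) (l : Lam H) (d : ℤ) :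
    ∏ᶠ m : Z2, χ (l.1 m) ^ d = 1 := by
  have hs : Function.mulSupport (fun m => χ (l.1 m) ^ d) ⊆ (l.1.support : Set Z2) := by
    intro m hm
    simp only [Function.mem_mulSupport] at hm
    simp only [Finset.mem_coe, Finsupp.mem_support_iff]
    intro h0
    exact hm (by simp [h0])
  have h := l.2
  simp only [Lam, AddMonoidHom.mem_ker, Finsupp.liftAddHom_apply, AddMonoidHom.id_apply,
    Finsupp.sum] at h
  rw [finprod_eq_prod_of_mulSupport_subset _ hs, Finset.prod_zpow]
  have : ∏ m ∈ l.1.support, χ (l.1 m) = χ (∑ m ∈ l.1.support, l.1 m) :=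
    (map_prod χ.toMonoidHom (fun m => Multiplicative.ofAdd (l.1 m)) l.1.support).symm
  rw [this, h, AddChar.map_zero_eq_one, one_zpow]

theorem twist_mul (χ : AddChar H Circle) (g h : Gam) (l : Lam H) :
    twist χ (g * h) l = twist χ g (h • l) * twist χ h l := by
  have e : twist χ g (h • l) =
      ∏ᶠ m : Z2, χ (l.1 m) ^ det2 g.left.toAdd (Matrix.mulVec g.right (h • m)) := by
    rw [twist_eq, ← finprod_comp_equiv (MulAction.toPerm h)]
    refine finprod_congr fun m => ?_
    rw [lam_smul_apply, MulAction.toPerm_apply, inv_smul_smul]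
  have key : twist χ (g * h) l * ∏ᶠ m : Z2, χ (l.1 m) ^
      (det2 g.left.toAdd (Matrix.mulVec g.right h.left.toAdd)) =
      twist χ g (h • l) * twist χ h l := by
    rw [e, twist_eq, twist_eq,
      ← finprod_mul_distrib (hasFiniteMulSupport_twist χ l _) (hasFiniteMulSupport_twist χ l _),
      ← finprod_mul_distrib (hasFiniteMulSupport_twist χ l _) (hasFiniteMulSupport_twist χ l _)]
    refine finprod_congr fun m => ?_
    rw [← zpow_add, ← zpow_add]
    congr 1
    have h1 : (g * h).left.toAdd = g.left.toAdd + Matrix.mulVec g.right h.left.toAdd := rfl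
    have h2 : Matrix.mulVec (g * h).right m =
        Matrix.mulVec (g.right : Matrix (Fin 2) (Fin 2) ℤ)
          (Matrix.mulVec (h.right : Matrix (Fin 2) (Fin 2) ℤ) m) := by
      rw [Matrix.mulVec_mulVec]; rfl
    rw [h1, h2, smul_def, Matrix.mulVec_add,
      ← det2_mulVec g.right h.left.toAdd (Matrix.mulVec h.right m)]
    simp only [det2, Pi.add_apply]
    ring
  rw [← key, prod_char_eq_one, mul_one]

/-- The unitary representation `δ_λ ↦ (∏ₘ χ((γ · λ)(m)) ^ det(k, m)) δ_{g · λ}`, `g = (k, γ)`,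
on `ℓ²(Λ(H))` that implements the action. -/
def implementing (χ : AddChar H Circle) : Gam →* unitary (EllTwo (Lam H) →L[ℂ] EllTwo (Lam H)) :=
  MonoidHom.mk' (fun g => weightedUnitary (MulAction.toPerm g) (twist χ g))
    (fun g h => by
      apply Subtype.ext
      refine ContinuousLinearMap.ext fun f => lp.ext (funext fun l => ?_)
      change _ = ((weightedUnitary (MulAction.toPerm g) (twist χ g) :
          EllTwo (Lam H) →L[ℂ] EllTwo (Lam H))
        ((weightedUnitary (MulAction.toPerm h) (twist χ h) :
          EllTwo (Lam H) →L[ℂ] EllTwo (Lam H)) f) : EllTwo (Lam H)) l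
      rw [weightedUnitary_apply, weightedUnitary_apply, weightedUnitary_apply]
      simp only [MulAction.toPerm_symm_apply, mul_inv_rev, mul_smul]
      rw [twist_mul, smul_inv_smul, Circle.coe_mul, mul_assoc])

theorem implementing_mul_u (μ : NormalizedCocycle H) (χ : AddChar H Circle) (g : Gam) (l : Lam H) :
    (implementing χ g : EllTwo (Lam H) →L[ℂ] EllTwo (Lam H)) * (u μ l).1 =
      ((twist χ g l : Circle) : ℂ) • ((u μ (g • l)).1 * (implementing χ g).1) := by
  refine ContinuousLinearMap.ext fun f => lp.ext (funext fun s => ?_)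
  change ((weightedUnitary (MulAction.toPerm g) (twist χ g) :
          EllTwo (Lam H) →L[ℂ] EllTwo (Lam H)) ((u μ l).1 f) : EllTwo (Lam H)) s =
      (twist χ g l : ℂ) * (((u μ (g • l)).1 ((weightedUnitary (MulAction.toPerm g) (twist χ g) :
          EllTwo (Lam H) →L[ℂ] EllTwo (Lam H)) f) : EllTwo (Lam H)) s)
  unfold u
  rw [weightedUnitary_apply, weightedUnitary_apply, weightedUnitary_apply, weightedUnitary_apply]
  simp only [MulAction.toPerm_symm_apply, Equiv.addLeft_symm, Equiv.coe_addLeft]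
  obtain ⟨t, rfl⟩ : ∃ t, s = g • (l + t) := ⟨-l + g⁻¹ • s, by simp⟩
  have h1 : -(g • l) + g • (l + t) = g • t := by rw [lam_smul_add]; abel
  have h2 : -l + (l + t) = t := by abel
  rw [h1, inv_smul_smul, inv_smul_smul, h2, tildeCocycle_smul, twist_add, Circle.coe_mul]
  ring

/-- Conjugation by the implementing unitaries permutes the generators up to scalars. -/
theorem conj_u (μ : NormalizedCocycle H) (χ : AddChar H Circle) (g : Gam) (l : Lam H) :
    Unitary.conjStarAlgAut ℂ _ (implementing χ g) (u μ l).1 =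
      ((twist χ g l : Circle) : ℂ) • (u μ (g • l)).1 := by
  rw [Unitary.conjStarAlgAut_apply, implementing_mul_u, smul_mul_assoc, mul_assoc,
    Unitary.mul_star_self_of_mem (implementing χ g).2, mul_one]

/-- The twisted Bernoulli shift action `β(H, μ, χ)` of `ℤ² ⋊ SL(2,ℤ)` on `N(H, μ)`: the action by
normal `*`-automorphisms with `β(k, γ)(u(λ)) = (∏ₘ χ((γ · λ)(m)) ^ det(k, m)) u((k, γ) · λ)`. -/
def twistedBernoulli (μ : NormalizedCocycle H) (χ : AddChar H Circle) :
    Gam →* (NAlg μ ≃⋆ₐ[ℂ] NAlg μ) :=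
  conjAction (generators μ) (implementing χ) (by
    rintro g _ ⟨l, rfl⟩
    refine ⟨(u μ (g⁻¹ • l)).1, ⟨_, rfl⟩, (twist χ g (g⁻¹ • l) : ℂ), Circle.coe_ne_zero _, ?_⟩
    rw [conj_u, smul_inv_smul])

theorem twistedBernoulli_u (μ : NormalizedCocycle H) (χ : AddChar H Circle) (g : Gam)
    (l : Lam H) :
    twistedBernoulli μ χ g ⟨(u μ l).1, u_mem μ l⟩ =
      ((twist χ g l : Circle) : ℂ) • (⟨(u μ (g • l)).1, u_mem μ (g • l)⟩ : NAlg μ) :=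
  Subtype.ext (conj_u μ χ g l)

/-- The character `χ_c(m) = c ^ m` of `ℤ`. -/
def charZ (c : Circle) : AddChar ℤ Circle where
  toFun m := c ^ m
  map_zero_eq_one' := zpow_zero c
  map_add_eq_mul' := zpow_add c

/-! ### The algebra `L^∞(X)` -/

variable {X : Type*} [MeasurableSpace X]

/-- The almost everywhere pointwise product on `L^∞(X)`. -/
instance instMulLinfty (ν : Measure X) : Mul (Lp ℂ ∞ ν) := ⟨fun f g => f • g⟩

theorem coeFn_Linfty_mul {ν : Measure X} (f g : Lp ℂ ∞ ν) :
    ⇑(f * g) =ᵐ[ν] fun x => f x * g x :=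
  Lp.coeFn_lpSMul f g

/-! ### Actions by `*`-automorphisms -/

section Actions

variable {G A B : Type*} [Group G]
  [Mul A] [Add A] [Star A] [SMul ℂ A] [Mul B] [Add B] [Star B] [SMul ℂ B]

/-- Two actions by `*`-automorphisms are conjugate if some `*`-isomorphism intertwines them. -/
def AreConjugate (α : G →* (A ≃⋆ₐ[ℂ] A)) (β : G →* (B ≃⋆ₐ[ℂ] B)) : Prop :=
  ∃ π : A ≃⋆ₐ[ℂ] B, ∀ (g : G) (a : A), π (α g a) = β g (π a)

/-- The centralizer of an action: the group of all `*`-automorphisms commuting with it. -/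
def actionCentralizer (β : G →* (A ≃⋆ₐ[ℂ] A)) : Subgroup (A ≃⋆ₐ[ℂ] A) :=
  Subgroup.centralizer (Set.range β)

/-- The action `g ↦ Φ ∘ β(g) ∘ Φ⁻¹` obtained by transport along a `*`-isomorphism `Φ`. -/
def transport (Φ : A ≃⋆ₐ[ℂ] B) (β : G →* (A ≃⋆ₐ[ℂ] A)) : G →* (B ≃⋆ₐ[ℂ] B) :=
  MonoidHom.mk' (fun g => (Φ.symm.trans (β g)).trans Φ) (fun g h => by
    ext b
    simp [StarAlgEquiv.trans_apply])

end Actions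

section ActionsOnLinfty

variable {G : Type*} [Group G] {ν : Measure X}

/-- The action preserves the trace `f ↦ ∫ f dν` of `L^∞(X)`. -/
def IsTracePreserving (β : G →* (Lp ℂ ∞ ν ≃⋆ₐ[ℂ] Lp ℂ ∞ ν)) : Prop :=
  ∀ (g : G) (f : Lp ℂ ∞ ν), ∫ x, β g f x ∂ν = ∫ x, f x ∂ν

/-- Any invariant element is a scalar multiple of `1`. -/
def IsErgodic (β : G →* (Lp ℂ ∞ ν ≃⋆ₐ[ℂ] Lp ℂ ∞ ν)) : Prop :=
  ∀ f : Lp ℂ ∞ ν, (∀ g : G, β g f = f) → ∃ z : ℂ, ⇑f =ᵐ[ν] fun _ => z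

/-- The (measure preserving) action is induced by an action of `G` on `X` by measure preserving
Borel isomorphisms, and each `g ≠ 1` fixes almost no point of `X`. -/
def IsEssentiallyFree (β : G →* (Lp ℂ ∞ ν ≃⋆ₐ[ℂ] Lp ℂ ∞ ν)) : Prop :=
  ∃ T : G → X ≃ᵐ X,
    (∀ g h x, T (g * h) x = T g (T h x)) ∧
    (∀ g, MeasurePreserving (T g) ν ν) ∧
    (∀ g f, ⇑(β g f) =ᵐ[ν] fun x => f ((T g).symm x)) ∧
    ∀ g, g ≠ 1 → ν {x | T g x = x} = 0

end ActionsOnLinfty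

/-- The parameters `c = e^{iπt}`, `0 < t < 1/2`. -/
def params : Set Circle :=
  (fun t : ℝ => Circle.exp (Real.pi * t)) '' Set.Ioo 0 (1 / 2)

end TwistedBernoulli

end

noncomputable section

namespace TwistedBernoulli

/-! ### Edges in `Λ(ℤ)` and the twist on them -/

section Edges

/-! The algebra is `L^∞` of the compact dual of `Λ(ℤ)`. On Fourier coefficients the action permutes
the indices by `Γ` and multiplies by the circle-valued twist (`IsCovariant`). On the dual, each `g`
is a group automorphism followed by a translation, so Haar measure is preserved. A fixed point of `g
≠ 1` satisfies `x(g⁻¹λ - λ) = const` for some `λ` moved by `g⁻¹`, and such a fiber of a nontrivial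
character is null (`measure_fiber_eq_zero`).

Coefficients are square summable and the action preserves their moduli. Hence an element fixed by
infinitely many `g n` has zero coefficient at every `λ` with a support point that the `g n` move to
distinct points (`IsCovariant.coef_eq_zero`). With translations this gives ergodicity.

The heart is `exists_apply_unit_edge`. Let `π` intertwine the actions for `c` and `d`, and let `v`
be the image under `π` of the unitary of the edge `δ_{e₁} - δ_0`. The horizontal shears fix this
unitary, so `v` has coefficients only at functions supported on the horizontal axis. By equivariance
the images of the edges from `e₁` to `e₁ + e₂` and from `0` to `e₁ + e₂` live on the line `x = 1`
and on the diagonal. The first two edges add up to the third, and two of these lines meet in one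
point, where no nonzero function of sum zero can be supported. So no cancellation occurs in the
product, and the triangle forces `v = z u(n · edge)`.

In `rigidity`, inverting `π` gives `n = ±1`, the half turn exchanging the ends of the edge gives `z
= ±1`, and the triangle gives `c = z d^n`. Thus `c` is one of `d`, `d̄`, `-d`, `-d̄`; both
parameters lie in the open first quadrant, so `z = n = 1` and `c = d`. Then `π` fixes the unitaries
of all `Γ`-translates of the edge, which generate `Λ(ℤ)` (`edges_generate`).

No normality of `π` is assumed. That an automorphism fixing all characters is the identity is shown
by passing from trigonometric polynomials to continuous functions, then to closed sets, Borel sets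
and bounded functions (`eq_refl_of_map_charLp`). -/

theorem lam_sum_eq_zero (l : Lam ℤ) : (l.1.sum fun _ n => n) = 0 := by
  exact AddMonoidHom.mem_ker.1 l.2

/-- The element `δ_q - δ_p` of `Λ(ℤ)`. -/
def edge (p q : Z2) : Lam ℤ :=
  ⟨Finsupp.single q 1 - Finsupp.single p 1, by
    rw [Lam, AddMonoidHom.mem_ker, map_sub, Finsupp.liftAddHom_apply_single,
      Finsupp.liftAddHom_apply_single, sub_self]⟩

theorem edge_apply (p q m : Z2) :
    (edge p q).1 m = (if q = m then 1 else 0) - (if p = m then 1 else 0) := by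
  classical
  simp [edge, Finsupp.single_apply]

theorem edge_add_edge (p q r : Z2) : edge p q + edge q r = edge p r := by
  apply Subtype.ext
  simp [edge]

theorem edge_self (p : Z2) : edge p p = 0 := by
  rw [← add_eq_left (a := edge p p), edge_add_edge]

theorem neg_edge (p q : Z2) : -edge p q = edge q p := by
  apply Subtype.ext
  simp [edge]

theorem smul_edge (g : Gam) (p q : Z2) : g • edge p q = edge (g • p) (g • q) := by
  apply Subtype.ext
  ext m
  rw [lam_smul_apply, edge_apply, edge_apply]
  simp only [eq_inv_smul_iff]

/-- The element `(k, γ)` of `ℤ² ⋊ SL(2,ℤ)`. -/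
def affine (k : Z2) (γ : SL2Z) : Gam := ⟨Multiplicative.ofAdd k, γ⟩

theorem affine_smul (k : Z2) (γ : SL2Z) (m : Z2) :
    affine k γ • m = k + Matrix.mulVec γ m := rfl

theorem lam_smul_zsmul (g : Gam) (n : ℤ) (l : Lam ℤ) : g • (n • l) = n • (g • l) := by
  apply Subtype.ext
  ext m
  rfl

theorem lam_smul_apply_smul (g : Gam) (l : Lam ℤ) (m : Z2) : (g • l).1 (g • m) = l.1 m := by
  rw [lam_smul_apply, inv_smul_smul]

/-- The rotation by a quarter turn, as an element of `SL(2,ℤ)`. -/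
def quarterTurn : SL2Z := ⟨!![0, -1; 1, 0], by simp [Matrix.det_fin_two]⟩

theorem quarterTurn_mulVec (m : Z2) : Matrix.mulVec quarterTurn m = ![-m 1, m 0] := by
  ext i
  fin_cases i <;> simp [quarterTurn, Matrix.mulVec, dotProduct, Fin.sum_univ_two]

/-- The first basis vector of `ℤ²`. -/
abbrev e₁ : Z2 := ![1, 0]

/-- The second basis vector of `ℤ²`. -/
abbrev e₂ : Z2 := ![0, 1]

/-- The vanishing sum forces opposite values at the two points. -/
theorem lam_eq_zsmul_edge {l : Lam ℤ} {p q : Z2} (hpq : p ≠ q)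
    (h : ∀ m, l.1 m ≠ 0 → m = p ∨ m = q) : l = l.1 q • edge p q := by
  classical
  have hs : l.1.support ⊆ {p, q} := by
    intro m hm
    simpa using h m (Finsupp.mem_support_iff.1 hm)
  have h0 := lam_sum_eq_zero l
  rw [Finsupp.sum_of_support_subset _ hs _ (by simp), Finset.sum_pair hpq] at h0
  apply Subtype.ext
  ext m
  change l.1 m = l.1 q * (edge p q).1 m
  rw [edge_apply]
  by_cases hmq : q = m
  · subst hmq
    simp [hpq]
  · by_cases hmp : p = m
    · subst hmp
      simp only [hmq, if_true, if_false]
      lia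
    · have : l.1 m = 0 := by
        by_contra hm
        rcases h m hm with h' | h'
        · exact hmp h'.symm
        · exact hmq h'.symm
      simp [this, hmq, hmp]

theorem lam_eq_zero_of_support_subset_singleton {l : Lam ℤ} {p : Z2}
    (h : ∀ m, l.1 m ≠ 0 → m = p) : l = 0 := by
  classical
  have hs : l.1.support ⊆ {p} := by
    intro m hm
    simpa using h m (Finsupp.mem_support_iff.1 hm)
  have h0 := lam_sum_eq_zero l
  rw [Finsupp.sum_of_support_subset _ hs _ (by simp), Finset.sum_singleton] at h0
  apply Subtype.ext
  ext m
  by_contra hm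
  have := h m hm
  subst this
  exact hm h0

theorem twist_zero (χ : AddChar ℤ Circle) (g : Gam) : twist χ g 0 = 1 := by
  have h := twist_add χ g 0 0
  rw [add_zero] at h
  exact (mul_eq_left.1 h.symm)

/-- The twist as an additive character of `Λ(ℤ)`. -/
def twistChar (χ : AddChar ℤ Circle) (g : Gam) : AddChar (Lam ℤ) Circle where
  toFun := twist χ g
  map_zero_eq_one' := twist_zero χ g
  map_add_eq_mul' := twist_add χ g

theorem twist_zsmul (χ : AddChar ℤ Circle) (g : Gam) (n : ℤ) (l : Lam ℤ) :
    twist χ g (n • l) = twist χ g l ^ n :=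
  AddChar.map_zsmul_eq_zpow (twistChar χ g) n l

/-- Basing the edge at `0` leaves a single factor, because the determinant vanishes at `γ 0 = 0`. -/
theorem twist_edge (c : Circle) (k : Z2) (γ : SL2Z) (q : Z2) :
    twist (charZ c) (affine k γ) (edge 0 q) = c ^ det2 k (Matrix.mulVec γ q) := by
  classical
  by_cases hq : q = 0
  · subst hq
    rw [edge_self, twist_zero]
    simp [det2]
  · rw [twist_eq]
    have : (Function.mulSupport fun m : Z2 => charZ c ((edge 0 q).1 m) ^
        det2 (affine k γ).left.toAdd (Matrix.mulVec (affine k γ).right m)) ⊆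
        (({q} : Finset Z2) : Set Z2) := by
      intro m hm
      by_contra hne
      apply hm
      simp only [Finset.coe_singleton, Set.mem_singleton_iff] at hne
      by_cases h0 : m = 0
      · subst h0
        simp [det2]
      · simp [edge_apply, Ne.symm hne, Ne.symm h0]
    rw [finprod_eq_prod_of_mulSupport_subset _ this, Finset.prod_singleton, edge_apply,
      if_pos rfl, if_neg (Ne.symm hq)]
    change (c ^ (1 - 0 : ℤ)) ^ _ = _
    simp [affine]

/-- Translations and the quarter turn produce all unit steps of the lattice. Steps telescope to
edges from `0` to any point, and these span because the values of `l` sum to zero. -/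
theorem edges_generate {S : AddSubgroup (Lam ℤ)} (h : ∀ g : Gam, g • edge 0 e₁ ∈ S) (l : Lam ℤ) :
    l ∈ S := by
  classical
  have h1 : ∀ k : Z2, edge k (k + e₁) ∈ S := fun k => by
    have := h (affine k 1)
    rw [smul_edge, affine_smul, affine_smul] at this
    simpa using this
  have h2 : ∀ k : Z2, edge k (k + e₂) ∈ S := fun k => by
    have := h (affine k quarterTurn)
    rw [smul_edge, affine_smul, affine_smul, quarterTurn_mulVec, quarterTurn_mulVec] at this
    have hz : (![-(0 : Z2) 1, (0 : Z2) 0] : Z2) = 0 := by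
      ext i
      fin_cases i <;> rfl
    have he : (![-e₁ 1, e₁ 0] : Z2) = e₂ := by
      ext i
      fin_cases i <;> rfl
    rwa [hz, he, add_zero] at this
  have hstep : ∀ d : Z2, (∀ k, edge k (k + d) ∈ S) → ∀ (n : ℤ) (k : Z2),
      edge k (k + n • d) ∈ S := by
    intro d hd n
    induction n using Int.induction_on with
    | zero =>
      intro k
      rw [zero_smul, add_zero, edge_self]
      exact S.zero_mem
    | succ n ih =>
      intro k
      have := S.add_mem (ih k) (hd (k + (n : ℤ) • d))
      rwa [edge_add_edge, add_assoc, ← add_one_zsmul] at this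
    | pred n ih =>
      intro k
      have := S.sub_mem (ih k) (hd (k + (-(n : ℤ) - 1) • d))
      rw [add_assoc, ← add_one_zsmul, sub_add_cancel, sub_eq_add_neg, neg_edge,
        edge_add_edge] at this
      exact this
  have h3 : ∀ m : Z2, edge 0 m ∈ S := by
    intro m
    have := S.add_mem (hstep e₁ h1 (m 0) 0) (hstep e₂ h2 (m 1) (0 + m 0 • e₁))
    rw [edge_add_edge] at this
    convert this using 2
    ext i
    fin_cases i <;> simp
  -- The terms at the base point `0` add up to minus the sum of the values of `l`, which is zero.
  have h4 : l = ∑ m ∈ l.1.support, l.1 m • edge 0 m := by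
    apply Subtype.ext
    rw [AddSubgroup.val_finsetSum]
    have : ∀ m ∈ l.1.support, ((l.1 m • edge 0 m : Lam ℤ) : Z2 →₀ ℤ) =
        Finsupp.single m (l.1 m) - l.1 m • Finsupp.single 0 1 := by
      intro m _
      rw [AddSubgroup.coe_zsmul]
      simp [edge, smul_sub]
    rw [Finset.sum_congr rfl this, Finset.sum_sub_distrib, ← Finset.sum_smul]
    have h0 := lam_sum_eq_zero l
    rw [Finsupp.sum] at h0
    rw [h0, zero_smul, sub_zero]
    exact (Finsupp.sum_single l.1).symm
  rw [h4]
  exact S.sum_mem fun m _ => S.zsmul_mem (h3 m) _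

end Edges

/-! ### Algebras with a Fourier expansion, and rigidity of twisted shifts -/

/-- A complex algebra whose elements have square summable Fourier coefficients along an abelian
group of unitaries. -/
structure FourierExpansion (Λ A : Type*) [AddCommGroup Λ] [Ring A] [Algebra ℂ A] where
  /-- The generating invertible elements. -/
  unit : Λ → A
  /-- The Fourier coefficients. -/
  coef : A →ₗ[ℂ] (Λ → ℂ)
  coef_injective : Function.Injective coef
  coef_unit_self : ∀ l, coef (unit l) l = 1
  coef_unit_of_ne : ∀ l s, s ≠ l → coef (unit l) s = 0
  unit_zero : unit 0 = 1
  unit_add : ∀ l s, unit (l + s) = unit l * unit s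
  summable_coef : ∀ a, Summable fun l => ‖coef a l‖ ^ 2
  hasSum_mul : ∀ a b l, HasSum (fun s => coef a s * coef b (l - s)) (coef (a * b) l)

namespace FourierExpansion

section General

variable {Λ A : Type*} [AddCommGroup Λ] [Ring A] [Algebra ℂ A] (F : FourierExpansion Λ A)

/-- Square summable coefficients tend to zero along the cofinite filter. -/
theorem finite_setOf_norm_coef_eq (a : A) {r : ℝ} (hr : r ≠ 0) :
    {l | ‖F.coef a l‖ = r}.Finite := by
  have h := (F.summable_coef a).tendsto_cofinite_zero
  have hpos : 0 < r ^ 2 := by positivity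
  have := h.eventually (gt_mem_nhds hpos)
  refine (Filter.eventually_cofinite.1 this).subset fun l hl => ?_
  simp only [Set.mem_ofPred_eq] at hl ⊢
  rw [hl]
  exact lt_irrefl _

theorem eq_smul_unit {a : A} {l : Λ} (h : ∀ s, F.coef a s ≠ 0 → s = l) :
    a = F.coef a l • F.unit l := by
  apply F.coef_injective
  rw [map_smul]
  ext s
  rw [Pi.smul_apply, smul_eq_mul]
  by_cases hs : s = l
  · subst hs
    rw [F.coef_unit_self, mul_one]
  · rw [F.coef_unit_of_ne l s hs, mul_zero]
    by_contra h0
    exact hs (h s h0)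

theorem exists_coef_ne_zero {a : A} (ha : a ≠ 0) : ∃ l, F.coef a l ≠ 0 := by
  by_contra! h
  exact ha (F.coef_injective (by rw [map_zero]; exact funext h))

theorem unit_ne_zero (l : Λ) : F.unit l ≠ 0 := by
  intro h
  have := F.coef_unit_self l
  rw [h, map_zero] at this
  exact zero_ne_one this

theorem smul_unit_inj {z w : ℂ} {l s : Λ} (hz : z ≠ 0) (h : z • F.unit l = w • F.unit s) :
    l = s ∧ z = w := by
  have h1 := congrArg (fun a => F.coef a l) h
  simp only [map_smul, Pi.smul_apply, F.coef_unit_self, smul_eq_mul, mul_one] at h1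
  by_cases hls : l = s
  · subst hls
    rw [F.coef_unit_self, mul_one] at h1
    exact ⟨rfl, h1⟩
  · rw [F.coef_unit_of_ne s l hls, mul_zero] at h1
    exact absurd h1 hz

theorem unit_neg_mul (l : Λ) : F.unit (-l) * F.unit l = 1 := by
  rw [← F.unit_add, neg_add_cancel, F.unit_zero]

/-- The elements `l` whose unitaries are mapped by `π` to multiples of the unitaries of `n l`. -/
def multiplesSubgroup (π : A ≃ₐ[ℂ] A) (n : ℤ) : AddSubgroup Λ where
  carrier := {l | ∃ z : ℂ, z ≠ 0 ∧ π (F.unit l) = z • F.unit (n • l)}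
  zero_mem' := ⟨1, one_ne_zero, by rw [smul_zero, F.unit_zero, map_one, one_smul]⟩
  add_mem' := by
    rintro l s ⟨z, hz, h⟩ ⟨w, hw, h'⟩
    refine ⟨z * w, mul_ne_zero hz hw, ?_⟩
    rw [F.unit_add, map_mul, h, h', smul_mul_smul_comm, ← F.unit_add, smul_add]
  neg_mem' := by
    rintro l ⟨z, hz, h⟩
    refine ⟨z⁻¹, inv_ne_zero hz, ?_⟩
    have h1 : π (F.unit (-l)) * (z • F.unit (n • l)) = 1 := by
      rw [← h, ← map_mul, F.unit_neg_mul, map_one]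
    have h2 : (z • F.unit (n • l)) * (z⁻¹ • F.unit (n • -l)) = 1 := by
      rw [smul_mul_smul_comm, mul_inv_cancel₀ hz, one_smul, ← F.unit_add, smul_neg,
        add_neg_cancel, F.unit_zero]
    exact left_inv_eq_right_inv h1 h2

/-- The elements `l` whose unitaries are fixed by `π`. -/
def fixedSubgroup (π : A ≃ₐ[ℂ] A) : AddSubgroup Λ where
  carrier := {l | π (F.unit l) = F.unit l}
  zero_mem' := by
    change π (F.unit 0) = F.unit 0
    rw [F.unit_zero, map_one]
  add_mem' := by
    intro l s h h'
    change π (F.unit (l + s)) = F.unit (l + s)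
    rw [F.unit_add, map_mul, h, h']
  neg_mem' := by
    intro l h
    have h1 : π (F.unit (-l)) * F.unit l = 1 := by
      have h' : π (F.unit l) = F.unit l := h
      conv_lhs => rw [← h', ← map_mul, F.unit_neg_mul, map_one]
    exact left_inv_eq_right_inv h1 (by rw [← F.unit_add, add_neg_cancel, F.unit_zero])

end General

/-! ### Twisted shifts on Fourier coefficients, and ergodicity -/

section Covariant

variable {A : Type*} [Ring A] [Algebra ℂ A] (F : FourierExpansion (Lam ℤ) A)

/-- The action is the twisted shift on Fourier coefficients. -/
def IsCovariant (c : Circle) (β : Gam → A → A) : Prop :=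
  ∀ g a l, F.coef (β g a) (g • l) = twist (charZ c) g l * F.coef a l

variable {F}

/-- Otherwise the coefficients at all `g n • l` share one nonzero modulus, so these indices form a
finite set. The union of their supports would be finite, yet it contains the infinitely many points
`g n • m`. -/
theorem IsCovariant.coef_eq_zero {c : Circle} {β : Gam → A → A} (hβ : F.IsCovariant c β)
    {a : A} (g : ℕ → Gam) (ha : ∀ n, β (g n) a = a) {l : Lam ℤ} {m : Z2} (hm : l.1 m ≠ 0)
    (hg : Function.Injective fun n => g n • m) : F.coef a l = 0 := by
  by_contra h0
  have hfin := F.finite_setOf_norm_coef_eq a (norm_ne_zero_iff.2 h0)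
  have hfin2 := hfin.biUnion (t := fun s : Lam ℤ => (s.1.support : Set Z2))
    fun s _ => s.1.support.finite_toSet
  refine Set.infinite_range_of_injective hg (hfin2.subset ?_)
  rintro _ ⟨n, rfl⟩
  refine Set.mem_biUnion (x := g n • l) ?_ ?_
  · have := hβ (g n) a l
    rw [ha n] at this
    simp only [Set.mem_ofPred_eq]
    rw [this, norm_mul, Circle.norm_coe, one_mul]
  · simp only [Finset.mem_coe, Finsupp.mem_support_iff]
    rwa [lam_smul_apply_smul]

theorem IsCovariant.ergodic {c : Circle} {β : Gam → A → A} (hβ : F.IsCovariant c β)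
    {a : A} (ha : ∀ g, β g a = a) : ∃ z : ℂ, a = z • (1 : A) := by
  refine ⟨F.coef a 0, ?_⟩
  rw [← F.unit_zero]
  refine F.eq_smul_unit fun l hl => ?_
  by_contra hne
  obtain ⟨m, hm⟩ : ∃ m, l.1 m ≠ 0 := by
    by_contra! h
    exact hne (Subtype.ext (Finsupp.ext h))
  -- Horizontal translations move every lattice point to infinitely many places.
  refine hl (hβ.coef_eq_zero (fun n : ℕ => affine ![n, 0] 1) (fun n => ha _) hm ?_)
  intro n n' h
  have := congrFun h 0
  simpa [affine_smul] using this

theorem IsCovariant.apply_unit {c : Circle} {β : Gam → A → A} (hβ : F.IsCovariant c β)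
    (g : Gam) (l : Lam ℤ) : β g (F.unit l) = (twist (charZ c) g l : ℂ) • F.unit (g • l) := by
  have h : ∀ s, F.coef (β g (F.unit l)) s ≠ 0 → s = g • l := by
    intro s hs
    by_contra hne
    apply hs
    have := hβ g (F.unit l) (g⁻¹ • s)
    rw [smul_inv_smul] at this
    rw [this, F.coef_unit_of_ne, mul_zero]
    rintro rfl
    exact hne (smul_inv_smul g s).symm
  have := F.eq_smul_unit h
  rwa [hβ, F.coef_unit_self, mul_one] at this

end Covariant

/-- The shear `(x, y) ↦ (x + n y, y)`. -/
def shear (n : ℤ) : SL2Z := ⟨!![1, n; 0, 1], by simp [Matrix.det_fin_two]⟩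

theorem shear_mulVec (n : ℤ) (m : Z2) : Matrix.mulVec (shear n) m = ![m 0 + n * m 1, m 1] := by
  ext i
  fin_cases i <;> simp [shear, Matrix.mulVec, dotProduct, Fin.sum_univ_two]

/-- The shear `(x, y) ↦ (x, x + y)`. -/
def lowerShear : SL2Z := ⟨!![1, 0; 1, 1], by simp [Matrix.det_fin_two]⟩

theorem lowerShear_mulVec (m : Z2) : Matrix.mulVec lowerShear m = ![m 0, m 0 + m 1] := by
  ext i
  fin_cases i <;> simp [lowerShear, Matrix.mulVec, dotProduct, Fin.sum_univ_two]

/-! ### Rigidity of intertwining isomorphisms -/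

section Rigidity

variable {A : Type*} [Ring A] [Algebra ℂ A] {F : FourierExpansion (Lam ℤ) A}
  {c d : Circle} {βc βd : Gam → A → A}

theorem apply_unit_smul (hc : F.IsCovariant c βc) {π : A ≃ₐ[ℂ] A}
    (hπ : ∀ g a, π (βc g a) = βd g (π a)) (g : Gam) (l : Lam ℤ) :
    (twist (charZ c) g l : ℂ) • π (F.unit (g • l)) = βd g (π (F.unit l)) := by
  rw [← hπ]
  have : βc g (F.unit l) = _ := hc.apply_unit g l
  rw [this, map_smul]

/-- The twists are nonzero scalars, so the Fourier support of `π (F.unit l)` is equivariant in `l`.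
-/
theorem coef_apply_unit_smul_ne_zero_iff (hc : F.IsCovariant c βc)
    (hd : F.IsCovariant d βd) {π : A ≃ₐ[ℂ] A}
    (hπ : ∀ g a, π (βc g a) = βd g (π a)) (g : Gam) (l s : Lam ℤ) :
    F.coef (π (F.unit (g • l))) (g • s) ≠ 0 ↔ F.coef (π (F.unit l)) s ≠ 0 := by
  have h1 : F.coef (_ • _) (g • s) = _ :=
    congrArg (fun a => F.coef a (g • s)) (apply_unit_smul hc hπ g l)
  have h2 : F.coef (βd g (π (F.unit l))) (g • s) = _ := hd g (π (F.unit l)) s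
  rw [h2, map_smul, Pi.smul_apply, smul_eq_mul] at h1
  rw [← mul_ne_zero_iff_left (Circle.coe_ne_zero (twist (charZ c) g l)), h1,
    mul_ne_zero_iff_left (Circle.coe_ne_zero _)]

/-- Shear invariance confines the Fourier support to functions on one line; the relation between the
three sides of a lattice triangle then leaves a single multiple of the edge. -/
theorem exists_apply_unit_edge (hc : F.IsCovariant c βc)
    (hd : F.IsCovariant d βd) {π : A ≃ₐ[ℂ] A}
    (hπ : ∀ g a, π (βc g a) = βd g (π a)) :
    ∃ (n : ℤ) (z : ℂ), z ≠ 0 ∧ π (F.unit (edge 0 e₁)) = z • F.unit (n • edge 0 e₁) := by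
  set v := π (F.unit (edge 0 e₁)) with hv
  -- Shears with `k = 0` fix both ends of the edge and have trivial twist on it, so they fix `v`;
  -- off the axis their orbits are infinite.
  have hline : ∀ l, F.coef v l ≠ 0 → ∀ m, l.1 m ≠ 0 → m 1 = 0 := by
    intro l hl m hm
    by_contra h1
    refine hl (hd.coef_eq_zero (fun n : ℕ => affine 0 (shear n)) (fun n => ?_) hm ?_)
    · have := apply_unit_smul hc hπ (affine 0 (shear n)) (edge 0 e₁)
      rw [smul_edge, affine_smul, affine_smul, twist_edge, Matrix.mulVec_zero, shear_mulVec] at this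
      have hdet : det2 0 ![e₁ 0 + n * e₁ 1, e₁ 1] = 0 := by simp [det2]
      have he : (0 + ![e₁ 0 + n * e₁ 1, e₁ 1] : Z2) = e₁ := by
        ext i
        fin_cases i <;> simp
      rw [hdet, he, zpow_zero, Circle.coe_one, one_smul, add_zero] at this
      exact this.symm
    · intro n n' h
      have h0 : (affine 0 (shear n) • m) 0 = (affine 0 (shear n') • m) 0 := congrFun h 0
      rw [affine_smul, affine_smul, shear_mulVec, shear_mulVec] at h0
      simpa [h1] using h0
  set g₂ := affine e₁ quarterTurn with hg₂
  set g₃ := affine 0 lowerShear with hg₃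
  have hg₂m : ∀ m : Z2, g₂ • m = ![1 - m 1, m 0] := by
    intro m
    rw [hg₂, affine_smul, quarterTurn_mulVec]
    ext i
    fin_cases i <;> simp [sub_eq_add_neg]
  have hg₃m : ∀ m : Z2, g₃ • m = ![m 0, m 0 + m 1] := by
    intro m
    rw [hg₃, affine_smul, lowerShear_mulVec, zero_add]
  -- The triangle `0`, `e₁`, `e₁ + e₂`: `g₂` carries the first side to the second, `g₃` carries it
  -- to the hypotenuse.
  have htri : edge 0 e₁ + g₂ • edge 0 e₁ = g₃ • edge 0 e₁ := by
    have h1 : g₂ • (0 : Z2) = e₁ := by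
      rw [hg₂m]
      ext i
      fin_cases i <;> simp
    have h2 : g₃ • (0 : Z2) = 0 := by
      rw [hg₃m]
      ext i
      fin_cases i <;> simp
    have h3 : g₂ • e₁ = g₃ • e₁ := by
      rw [hg₃m, hg₂m]
      ext i
      fin_cases i <;> simp
    rw [smul_edge, smul_edge, h1, h2, h3, edge_add_edge]
  have hsupp : ∀ (g : Gam) (l : Lam ℤ), F.coef v l ≠ 0 → ∀ m, (g • l).1 m ≠ 0 →
      ∃ m' : Z2, m' 1 = 0 ∧ m = g • m' := by
    intro g l hl m hm
    exact ⟨g⁻¹ • m, hline l hl _ hm, (smul_inv_smul g m).symm⟩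
  have hsupp₂ : ∀ l : Lam ℤ, F.coef v l ≠ 0 → ∀ m, (g₂ • l).1 m ≠ 0 → m 0 = 1 := by
    intro l hl m hm
    obtain ⟨m', h', rfl⟩ := hsupp g₂ l hl m hm
    rw [hg₂m]
    simp [h']
  have hmul : ∀ l l', F.coef v l ≠ 0 → F.coef v l' ≠ 0 →
      F.coef (π (F.unit (g₃ • edge 0 e₁))) (l + g₂ • l') ≠ 0 := by
    intro l l' hl hl'
    rw [← htri, F.unit_add, map_mul]
    have hs := F.hasSum_mul v (π (F.unit (g₂ • edge 0 e₁))) (l + g₂ • l')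
    -- Only `s = l` contributes to the convolution: `s - l` is supported on the axis and also on the
    -- line `x = 1`, hence at `e₁` alone, and its values sum to zero.
    have hone := hasSum_single (f := fun s => F.coef v s *
      F.coef (π (F.unit (g₂ • edge 0 e₁))) (l + g₂ • l' - s)) l (fun s hsl => by
        by_contra hne
        obtain ⟨h1, h2⟩ := mul_ne_zero_iff.1 hne
        apply hsl
        have ht : l + g₂ • l' - s = g₂ • (g₂⁻¹ • (l + g₂ • l' - s)) := (smul_inv_smul _ _).symm
        set t := g₂⁻¹ • (l + g₂ • l' - s) with htdef
        rw [ht, coef_apply_unit_smul_ne_zero_iff hc hd hπ] at h2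
        have hsub : s - l = g₂ • l' - g₂ • t := by
          rw [← ht]
          abel
        rw [← sub_eq_zero]
        refine lam_eq_zero_of_support_subset_singleton (p := e₁) fun m hm => ?_
        have hm1 : m 1 = 0 := by
          have : s.1 m - l.1 m ≠ 0 := hm
          by_cases hz : s.1 m = 0
          · exact hline l hl m (by rw [hz, zero_sub, neg_ne_zero] at this; exact this)
          · exact hline s h1 m hz
        have hm0 : m 0 = 1 := by
          rw [hsub] at hm
          have : (g₂ • l').1 m - (g₂ • t).1 m ≠ 0 := hm
          by_cases hz : (g₂ • l').1 m = 0
          · exact hsupp₂ t h2 m (by rw [hz, zero_sub, neg_ne_zero] at this; exact this)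
          · exact hsupp₂ l' hl' m hz
        ext i
        fin_cases i
        · exact hm0
        · exact hm1)
    rw [hs.unique hone, add_sub_cancel_left]
    exact mul_ne_zero hl ((coef_apply_unit_smul_ne_zero_iff hc hd hπ _ _ _).2 hl')
  -- The product is the image of the hypotenuse, whose Fourier support consists of functions on the
  -- diagonal.
  have hdiag : ∀ l l', F.coef v l ≠ 0 → F.coef v l' ≠ 0 →
      ∀ m : Z2, (l + g₂ • l').1 m ≠ 0 → m 0 = m 1 := by
    intro l l' hl hl' m hm
    have h := hmul l l' hl hl'
    rw [← smul_inv_smul g₃ (l + g₂ • l'), coef_apply_unit_smul_ne_zero_iff hc hd hπ] at h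
    rw [← smul_inv_smul g₃ (l + g₂ • l')] at hm
    obtain ⟨m', h', rfl⟩ := hsupp g₃ _ h m hm
    rw [hg₃m]
    simp [h']
  have hmult : ∀ l, F.coef v l ≠ 0 → l = l.1 e₁ • edge 0 e₁ := by
    intro l hl
    refine lam_eq_zsmul_edge (fun h => by simpa using congrFun h 0) fun m hm => ?_
    have hm1 := hline l hl m hm
    by_cases hm0 : m 0 = 1
    · right
      ext i
      fin_cases i
      · exact hm0
      · exact hm1
    · left
      have hz : (g₂ • l).1 m = 0 := by
        by_contra h
        exact hm0 (hsupp₂ l hl m h)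
      -- A point of the axis other than `e₁` receives nothing from `g₂ • l`, so it must lie on the
      -- diagonal.
      have := hdiag l l hl hl m (by
        change l.1 m + (g₂ • l).1 m ≠ 0
        rwa [hz, add_zero])
      ext i
      fin_cases i
      · exact this.trans hm1
      · exact hm1
  have huniq : ∀ l l', F.coef v l ≠ 0 → F.coef v l' ≠ 0 → l.1 e₁ = l'.1 e₁ := by
    intro l l' hl hl'
    -- The corner `e₁` is off the diagonal, so the contributions of the two sides cancel there; this
    -- equates the multiples for `l` and `l'`.
    have h0 : (l + g₂ • l').1 e₁ = 0 := by
      by_contra h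
      simpa using hdiag l l' hl hl' _ h
    have h1 : (g₂ • l').1 e₁ = l'.1 0 := by
      have : e₁ = g₂ • (0 : Z2) := by
        rw [hg₂m]
        ext i
        fin_cases i <;> simp
      rw [this, lam_smul_apply_smul]
    have h2 : l'.1 0 = -l'.1 e₁ := by
      conv_lhs => rw [hmult l' hl']
      change l'.1 e₁ * (edge 0 e₁).1 0 = _
      rw [edge_apply, if_pos rfl, if_neg (fun h => by simpa using congrFun h 0)]
      ring
    have h3 : l.1 e₁ + (g₂ • l').1 e₁ = 0 := h0
    rw [h1, h2] at h3
    linarith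
  have hv0 : v ≠ 0 := by
    rw [hv, Ne, map_eq_zero_iff π π.injective]
    exact F.unit_ne_zero _
  obtain ⟨l, hl⟩ := F.exists_coef_ne_zero hv0
  refine ⟨l.1 e₁, F.coef v l, hl, ?_⟩
  rw [← hmult l hl]
  refine F.eq_smul_unit fun s hs => ?_
  rw [hmult l hl, hmult s hs, huniq s l hs hl]

theorem params_re_im_pos {c : Circle} (hc : c ∈ params) : 0 < (c : ℂ).re ∧ 0 < (c : ℂ).im := by
  obtain ⟨t, ⟨h0, h1⟩, rfl⟩ := hc
  have hpi := Real.pi_pos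
  rw [Circle.coe_exp, Complex.exp_ofReal_mul_I_re, Complex.exp_ofReal_mul_I_im]
  constructor
  · apply Real.cos_pos_of_mem_Ioo
    constructor <;> nlinarith
  · apply Real.sin_pos_of_pos_of_lt_pi <;> nlinarith

/-- An isomorphism that intertwines two twisted shifts with parameters in the open first quadrant
fixes all unitaries, and the parameters agree. -/
theorem rigidity (hc : F.IsCovariant c βc)
    (hd : F.IsCovariant d βd)
    {π : A ≃ₐ[ℂ] A} (hsmul : ∀ g (z : ℂ) a, βd g (z • a) = z • βd g a)
    (hπ : ∀ g a, π (βc g a) = βd g (π a)) (hcp : c ∈ params) (hdp : d ∈ params) :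
    c = d ∧ ∀ l, π (F.unit l) = F.unit l := by
  obtain ⟨n, z, hz, hn⟩ := exists_apply_unit_edge hc hd hπ
  have hπ' : ∀ g a, π.symm (βd g a) = βc g (π.symm a) := by
    intro g a
    rw [AlgEquiv.symm_apply_eq, hπ, AlgEquiv.apply_symm_apply]
  obtain ⟨k, w, hw, hk⟩ := exists_apply_unit_edge hd hc hπ'
  have he : (edge 0 e₁).1 e₁ = 1 := by
    rw [edge_apply, if_pos rfl, if_neg (fun h => by simpa using congrFun h 0), sub_zero]
  have hedge : ∀ {a b : ℤ}, a • edge 0 e₁ = b • edge 0 e₁ → a = b := by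
    intro a b h
    have h1 : a * (edge 0 e₁).1 e₁ = b * (edge 0 e₁).1 e₁ :=
      DFunLike.congr_fun (congrArg Subtype.val h) e₁
    rwa [he, mul_one, mul_one] at h1
  -- Since `π` multiplies the edge by `n` and its inverse by `k`, the composite identity gives `n k
  -- = 1`.
  have hnk : n * k = 1 := by
    have hmem : k • edge 0 e₁ ∈ F.multiplesSubgroup π n :=
      AddSubgroup.zsmul_mem _ (show edge 0 e₁ ∈ F.multiplesSubgroup π n from ⟨z, hz, hn⟩) k
    obtain ⟨y, hy, h⟩ := hmem
    rw [AlgEquiv.symm_apply_eq, map_smul, h, smul_smul] at hk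
    have h1 : (1 : ℂ) • F.unit (edge 0 e₁) = _ := (one_smul ℂ _).trans hk
    have h2 := (F.smul_unit_inj one_ne_zero h1).1
    rw [smul_smul] at h2
    exact (hedge ((one_smul ℤ _).trans h2)).symm
  have happ : ∀ g, (twist (charZ c) g (edge 0 e₁) : ℂ) • π (F.unit (g • edge 0 e₁)) =
      (z * ((twist (charZ d) g (edge 0 e₁) ^ n : Circle) : ℂ)) • F.unit (n • g • edge 0 e₁) := by
    intro g
    have hu : βd g (F.unit (n • edge 0 e₁)) = _ := hd.apply_unit g (n • edge 0 e₁)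
    rw [apply_unit_smul hc hπ, hn, hsmul, hu, smul_smul, twist_zsmul, lam_smul_zsmul]
  -- The half turn `m ↦ e₁ - m` reverses the edge with trivial twist, so `z` is the scalar for the
  -- edge and for its negative, whose unitaries are inverse.
  have hzz : z * z = 1 := by
    have h := happ (affine e₁ (-1))
    have hm : ((-1 : SL2Z) : Matrix (Fin 2) (Fin 2) ℤ).mulVec e₁ = -e₁ := by
      rw [Matrix.SpecialLinearGroup.coe_neg, Matrix.SpecialLinearGroup.coe_one, Matrix.neg_mulVec,
        Matrix.one_mulVec]
    have hdet : det2 e₁ (-e₁) = 0 := by simp [det2]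
    have hs : affine e₁ (-1) • edge 0 e₁ = -edge 0 e₁ := by
      rw [smul_edge, affine_smul, affine_smul, hm, Matrix.mulVec_zero, add_zero, add_neg_cancel,
        neg_edge]
    rw [twist_edge, twist_edge, hm, hdet, zpow_zero, zpow_zero, one_zpow, Circle.coe_one, one_smul,
      mul_one, hs] at h
    have h1 : (1 : ℂ) • F.unit 0 = (z * z) • F.unit 0 := by
      rw [one_smul]
      conv_lhs => rw [F.unit_zero, ← map_one π, ← F.unit_neg_mul (edge 0 e₁), map_mul, h, hn,
        smul_mul_smul_comm, ← F.unit_add, smul_neg, neg_add_cancel]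
    exact (F.smul_unit_inj one_ne_zero h1).2.symm
  -- In the triangle only the vertical side is twisted, with exponent `det(e₁, e₂) = 1`. Comparing
  -- scalars gives `c z = z (z d^n)`.
  have hzd : z * ((d ^ n : Circle) : ℂ) = c := by
    have h2 := happ (affine e₁ quarterTurn)
    have h3 := happ (affine 0 lowerShear)
    have hq : Matrix.mulVec quarterTurn e₁ = e₂ := by
      rw [quarterTurn_mulVec]
      ext i
      fin_cases i <;> simp
    have hl : Matrix.mulVec lowerShear e₁ = e₁ + e₂ := by
      rw [lowerShear_mulVec]
      ext i
      fin_cases i <;> simp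
    have hdet : det2 e₁ e₂ = 1 := by simp [det2]
    have hdet0 : det2 0 (e₁ + e₂) = 0 := by simp [det2]
    rw [twist_edge, twist_edge, hq, hdet, zpow_one, zpow_one, smul_edge, affine_smul, affine_smul,
      hq, Matrix.mulVec_zero, add_zero] at h2
    rw [twist_edge, twist_edge, hl, hdet0, zpow_zero, zpow_zero, one_zpow, Circle.coe_one, one_smul,
      mul_one, smul_edge, affine_smul, affine_smul, hl, Matrix.mulVec_zero, zero_add, zero_add] at h3
    have h1 : (c * z : ℂ) • F.unit (n • edge 0 (e₁ + e₂)) =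
        (z * (z * ((d ^ n : Circle) : ℂ))) • F.unit (n • edge 0 (e₁ + e₂)) := by
      rw [mul_smul]
      conv_lhs => rw [← h3, ← edge_add_edge 0 e₁ (e₁ + e₂), F.unit_add, map_mul,
        ← mul_smul_comm, h2, hn, smul_mul_smul_comm, ← F.unit_add, ← smul_add, edge_add_edge]
    have h4 := (F.smul_unit_inj (mul_ne_zero (Circle.coe_ne_zero c) hz) h1).2
    rw [mul_comm] at h4
    exact (mul_left_cancel₀ hz h4).symm
  obtain ⟨hcre, hcim⟩ := params_re_im_pos hcp
  obtain ⟨hdre, hdim⟩ := params_re_im_pos hdp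
  have hn1 : n = 1 ∧ z = 1 := by
    -- The four sign choices give `c = d`, `d̄`, `-d`, `-d̄`; only the first stays in the open first
    -- quadrant.
    rcases mul_self_eq_one_iff.1 hzz with rfl | rfl <;>
    rcases Int.eq_one_or_neg_one_of_mul_eq_one hnk with rfl | rfl
    · exact ⟨rfl, rfl⟩
    · exfalso
      rw [one_mul, zpow_neg, zpow_one, Circle.coe_inv_eq_conj] at hzd
      rw [← hzd, Complex.conj_im] at hcim
      linarith
    · exfalso
      rw [neg_one_mul, zpow_one] at hzd
      rw [← hzd, Complex.neg_re] at hcre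
      linarith
    · exfalso
      rw [neg_one_mul, zpow_neg, zpow_one, Circle.coe_inv_eq_conj] at hzd
      rw [← hzd, Complex.neg_re, Complex.conj_re] at hcre
      linarith
  obtain ⟨rfl, rfl⟩ := hn1
  have hcd : c = d := by
    rw [one_mul, zpow_one] at hzd
    exact Circle.ext hzd.symm
  subst hcd
  refine ⟨rfl, edges_generate (S := F.fixedSubgroup π) fun g => ?_⟩
  have h := happ g
  rw [one_mul, zpow_one, one_smul] at h
  exact smul_right_injective A (Circle.coe_ne_zero _) h

end Rigidity
end FourierExpansion

/-! ### Double commutants of translation unitaries -/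

section Translations

variable {Λ : Type*} [AddCommGroup Λ] {K : Type*} [NormedAddCommGroup K] [InnerProductSpace ℂ K]

theorem ext_hilbertBasis {K' : Type*} [NormedAddCommGroup K'] [NormedSpace ℂ K'] {ι : Type*}
    (b : HilbertBasis ι ℂ K) {S T : K →L[ℂ] K'} (h : ∀ i, S (b i) = T (b i)) : S = T :=
  ContinuousLinearMap.ext_on
    (Submodule.dense_iff_topologicalClosure_eq_top.2 b.dense_span) (by
      rintro _ ⟨i, rfl⟩
      exact h i)

/-- The operators `v l` translate the orthonormal basis `b`. -/
def IsTranslation (b : HilbertBasis Λ ℂ K) (v : Λ → K →L[ℂ] K) : Prop :=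
  ∀ l s, v l (b s) = b (l + s)

variable {b : HilbertBasis Λ ℂ K} {v : Λ → K →L[ℂ] K}

namespace IsTranslation

theorem map_zero (hv : IsTranslation b v) : v 0 = 1 :=
  ext_hilbertBasis b fun s => by rw [hv, zero_add]; rfl

theorem map_add (hv : IsTranslation b v) (l s : Λ) : v (l + s) = v l * v s :=
  ext_hilbertBasis b fun t => by
    rw [hv, mul_apply_eq_comp, hv, hv, add_assoc]

theorem apply_basis (hv : IsTranslation b v) {a : K →L[ℂ] K}
    (ha : ∀ l, v l * a = a * v l) (l : Λ) : a (b l) = v l (a (b 0)) := by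
  have h := DFunLike.congr_fun (ha l) (b 0)
  rw [mul_apply_eq_comp, mul_apply_eq_comp, hv, add_zero] at h
  exact h.symm

theorem commute (hv : IsTranslation b v) (l s : Λ) : v l * v s = v s * v l := by
  rw [← hv.map_add, ← hv.map_add, add_comm]

theorem ext_of_commute (hv : IsTranslation b v) {a a' : K →L[ℂ] K}
    (ha : ∀ l, v l * a = a * v l) (ha' : ∀ l, v l * a' = a' * v l) (h : a (b 0) = a' (b 0)) :
    a = a' :=
  ext_hilbertBasis b fun l => by rw [hv.apply_basis ha, hv.apply_basis ha', h]

variable [CompleteSpace K]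

theorem star_eq (hv : IsTranslation b v) (l : Λ) : star (v l) = v (-l) := by
  classical
  refine ext_hilbertBasis b fun s => b.repr.injective (lp.ext (funext fun t => ?_))
  rw [b.repr_apply_apply, b.repr_apply_apply, ContinuousLinearMap.star_eq_adjoint,
    ContinuousLinearMap.adjoint_inner_right, hv, hv,
    orthonormal_iff_ite.1 b.orthonormal, orthonormal_iff_ite.1 b.orthonormal]
  congr 1
  rw [eq_iff_iff, eq_neg_add_iff_add_eq]

theorem mem_centralizer_iff (hv : IsTranslation b v) {a : K →L[ℂ] K} :
    a ∈ StarSubalgebra.centralizer ℂ (Set.range v) ↔ ∀ l, v l * a = a * v l := by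
  rw [StarSubalgebra.mem_centralizer_iff]
  constructor
  · intro h l
    exact (h _ ⟨l, rfl⟩).1
  · rintro h _ ⟨l, rfl⟩
    refine ⟨h l, ?_⟩
    rw [hv.star_eq, h]

/-- As the group is abelian, each `v l` lies in the commutant of the translations. -/
theorem commute_of_mem (hv : IsTranslation b v) {a : K →L[ℂ] K}
    (ha : a ∈ doubleCommutant (Set.range v)) (l : Λ) : v l * a = a * v l := by
  unfold doubleCommutant at ha
  rw [StarSubalgebra.mem_centralizer_iff] at ha
  exact (ha (v l) (hv.mem_centralizer_iff.2 fun s => hv.commute s l)).1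

/-- The matrix of an operator commuting with translations is constant along diagonals, so
composition becomes convolution of the coefficients at `b 0`. -/
theorem inner_apply_basis (hv : IsTranslation b v) {a : K →L[ℂ] K}
    (ha : ∀ l, v l * a = a * v l) (l s : Λ) :
    ⟪b s, a (b l)⟫_ℂ = ⟪b (s - l), a (b 0)⟫_ℂ := by
  rw [hv.apply_basis ha, ← ContinuousLinearMap.adjoint_inner_left,
    ← ContinuousLinearMap.star_eq_adjoint, hv.star_eq, hv, neg_add_eq_sub]

theorem hasSum_inner_mul (hv : IsTranslation b v) {a a' : K →L[ℂ] K}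
    (ha' : ∀ l, v l * a' = a' * v l) (l : Λ) :
    HasSum (fun s => ⟪b s, a (b 0)⟫_ℂ * ⟪b (l - s), a' (b 0)⟫_ℂ) ⟪b l, (a' * a) (b 0)⟫_ℂ := by
  have h := (b.hasSum_repr (a (b 0))).mapL ((innerSL ℂ (b l)).comp a')
  rw [show (fun s => ⟪b s, a (b 0)⟫_ℂ * ⟪b (l - s), a' (b 0)⟫_ℂ) = fun s =>
    ((innerSL ℂ (b l)).comp a') (b.repr (a (b 0)) s • b s) from ?_]
  · exact h
  refine funext fun s => ?_
  rw [ContinuousLinearMap.comp_apply, innerSL_apply_apply, map_smul, inner_smul_right,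
    hv.inner_apply_basis ha' s l, b.repr_apply_apply]

/-- The Fourier expansion of the double commutant of a group of translations. -/
def fourierExpansion (hv : IsTranslation b v) :
    FourierExpansion Λ (doubleCommutant (Set.range v)) where
  unit l := ⟨v l, subset_doubleCommutant _ ⟨l, rfl⟩⟩
  coef :=
    { toFun := fun a l => ⟪b l, a.1 (b 0)⟫_ℂ
      map_add' := fun a a' => funext fun l => inner_add_right _ _ _
      map_smul' := fun z a => funext fun l => inner_smul_right _ _ _ }
  coef_injective := fun a a' h => by
    refine Subtype.ext (hv.ext_of_commute (hv.commute_of_mem a.2) (hv.commute_of_mem a'.2) ?_)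
    refine b.repr.injective (lp.ext (funext fun l => ?_))
    rw [b.repr_apply_apply, b.repr_apply_apply]
    exact congrFun h l
  coef_unit_self l := by
    change ⟪b l, v l (b 0)⟫_ℂ = 1
    rw [hv, add_zero, inner_self_eq_norm_sq_to_K, b.orthonormal.1]
    simp
  coef_unit_of_ne l s hs := by
    change ⟪b s, v l (b 0)⟫_ℂ = 0
    rw [hv, add_zero]
    exact b.orthonormal.2 hs
  unit_zero := Subtype.ext hv.map_zero
  unit_add l s := Subtype.ext (hv.map_add l s)
  summable_coef a := b.orthonormal.inner_products_summable (a.1 (b 0))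
  hasSum_mul a a' l := by
    have h := hv.hasSum_inner_mul (a := a.1) (hv.commute_of_mem a'.2) l
    -- The double commutant is abelian: `a'` also lies in the commutant of the translations.
    have hc : a'.1 * a.1 = a.1 * a'.1 := by
      have := a.2
      unfold doubleCommutant at this
      rw [StarSubalgebra.mem_centralizer_iff] at this
      exact (this a'.1 (hv.mem_centralizer_iff.2 (hv.commute_of_mem a'.2))).1
    rw [hc] at h
    exact h

end IsTranslation

end Translations

/-! ### The compact dual of a countable discrete abelian group -/

section Dual

variable (Λ : Type*) [AddCommGroup Λ]

/-- The characters of `Λ`, as a subgroup of the functions from `Λ` to the circle. -/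
def dualSubgroup : Subgroup (Λ → Circle) where
  carrier := {x | ∀ l s, x (l + s) = x l * x s}
  one_mem' := fun l s => (mul_one 1).symm
  mul_mem' := by
    intro x y hx hy l s
    rw [Pi.mul_apply, Pi.mul_apply, Pi.mul_apply, hx, hy, mul_mul_mul_comm]
  inv_mem' := by
    intro x hx l s
    rw [Pi.inv_apply, Pi.inv_apply, Pi.inv_apply, hx, mul_inv]

/-- The compact dual group of `Λ`. -/
abbrev Dual := dualSubgroup Λ

theorem isClosed_dualSubgroup : IsClosed (dualSubgroup Λ : Set (Λ → Circle)) := by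
  have : (dualSubgroup Λ : Set (Λ → Circle)) = ⋂ l, ⋂ s, {x | x (l + s) = x l * x s} := by
    ext x
    simp only [Set.mem_iInter]
    rfl
  rw [this]
  refine isClosed_iInter fun l => isClosed_iInter fun s => isClosed_eq ?_ ?_ <;> fun_prop

instance : CompactSpace (Dual Λ) := isCompact_iff_compactSpace.1 (isClosed_dualSubgroup Λ).isCompact

instance : PolishSpace Circle :=
  haveI := EMetric.secondCountable_of_sigmaCompact Circle
  inferInstance

instance [Countable Λ] : PolishSpace (Dual Λ) := (isClosed_dualSubgroup Λ).polishSpace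

instance : MeasurableSpace (Dual Λ) := borel _

instance : BorelSpace (Dual Λ) := ⟨rfl⟩

instance [Countable Λ] : StandardBorelSpace (Dual Λ) := inferInstance

/-- The normalized Haar measure of the dual group. -/
def dualHaar : Measure (Dual Λ) := Measure.haarMeasure ⊤

instance : (dualHaar Λ).IsHaarMeasure := by
  unfold dualHaar
  infer_instance

instance : IsProbabilityMeasure (dualHaar Λ) := ⟨by
  have h := Measure.haarMeasure_self (K₀ := (⊤ : TopologicalSpace.PositiveCompacts (Dual Λ)))
  rwa [TopologicalSpace.PositiveCompacts.coe_top] at h⟩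

variable {Λ}

theorem dual_map_add (x : Dual Λ) (l s : Λ) : x.1 (l + s) = x.1 l * x.1 s := x.2 l s

theorem dual_map_zero (x : Dual Λ) : x.1 0 = 1 := by
  have h := x.2 0 0
  rw [add_zero] at h
  exact mul_eq_left.1 h.symm

theorem dual_map_neg (x : Dual Λ) (l : Λ) : x.1 (-l) = (x.1 l)⁻¹ := by
  rw [eq_inv_iff_mul_eq_one, ← dual_map_add x, neg_add_cancel, dual_map_zero x]

theorem continuous_dual_apply (l : Λ) : Continuous fun x : Dual Λ => x.1 l :=
  (_root_.continuous_apply l).comp continuous_subtype_val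

/-- Evaluation at `l`, as a continuous complex function on the dual group. -/
def evalChar (l : Λ) : C(Dual Λ, ℂ) :=
  ⟨fun x => (x.1 l : ℂ), continuous_subtype_val.comp (continuous_dual_apply l)⟩

theorem evalChar_apply (l : Λ) (x : Dual Λ) : evalChar l x = (x.1 l : ℂ) := rfl

theorem evalChar_mul (l s : Λ) : evalChar l * evalChar s = evalChar (l + s) := by
  ext x
  rw [ContinuousMap.mul_apply, evalChar_apply, evalChar_apply, evalChar_apply, dual_map_add x,
    Circle.coe_mul]

theorem evalChar_zero : (evalChar 0 : C(Dual Λ, ℂ)) = 1 := by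
  ext x
  rw [evalChar_apply, dual_map_zero x, Circle.coe_one, ContinuousMap.one_apply]

theorem star_evalChar (l : Λ) : star (evalChar l) = evalChar (-l) := by
  ext x
  rw [ContinuousMap.star_apply, evalChar_apply, evalChar_apply, dual_map_neg x, Circle.coe_inv_eq_conj,
    starRingEnd_apply]

/-- The trigonometric polynomials on the dual group. -/
def trigPolynomials (Λ : Type*) [AddCommGroup Λ] : StarSubalgebra ℂ C(Dual Λ, ℂ) where
  toSubalgebra := Algebra.adjoin ℂ (Set.range evalChar)
  star_mem' := by
    change Algebra.adjoin ℂ (Set.range evalChar) ≤ star (Algebra.adjoin ℂ (Set.range evalChar))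
    refine Algebra.adjoin_le ?_
    rintro - ⟨l, rfl⟩
    exact Algebra.subset_adjoin ⟨-l, (star_evalChar l).symm⟩

theorem trigPolynomials_toSubmodule :
    Subalgebra.toSubmodule (trigPolynomials Λ).toSubalgebra =
      Submodule.span ℂ (Set.range (evalChar (Λ := Λ))) := by
  apply Algebra.adjoin_eq_span_of_subset
  refine Set.Subset.trans ?_ Submodule.subset_span
  intro f hf
  refine Submonoid.closure_induction (fun _ => id) ⟨0, evalChar_zero⟩ ?_ hf
  rintro - - - - ⟨l, rfl⟩ ⟨s, rfl⟩
  exact ⟨l + s, (evalChar_mul l s).symm⟩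

/-- Stone–Weierstrass: distinct characters differ at some `l`, so the evaluations separate points.
-/
theorem trigPolynomials_closure : (trigPolynomials Λ).topologicalClosure = ⊤ := by
  apply ContinuousMap.starSubalgebra_topologicalClosure_eq_top_of_separatesPoints
  intro x y hxy
  obtain ⟨l, hl⟩ : ∃ l, x.1 l ≠ y.1 l := by
    by_contra! h
    exact hxy (Subtype.ext (funext h))
  refine ⟨_, ⟨evalChar l, Algebra.subset_adjoin ⟨l, rfl⟩, rfl⟩, ?_⟩
  exact fun h => hl (Circle.ext h)

theorem span_evalChar_closure :
    (Submodule.span ℂ (Set.range (evalChar (Λ := Λ)))).topologicalClosure = ⊤ := by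
  rw [← trigPolynomials_toSubmodule]
  exact congrArg (Subalgebra.toSubmodule <| StarSubalgebra.toSubalgebra ·) trigPolynomials_closure

/-- Evaluation at `l`, as an element of `Lᵖ` of the dual group. -/
def charLp (p : ℝ≥0∞) [Fact (1 ≤ p)] (l : Λ) : Lp ℂ p (dualHaar Λ) :=
  ContinuousMap.toLp (E := ℂ) p (dualHaar Λ) ℂ (evalChar l)

theorem coeFn_charLp (p : ℝ≥0∞) [Fact (1 ≤ p)] (l : Λ) :
    charLp p l =ᵐ[dualHaar Λ] fun x => (x.1 l : ℂ) :=
  ContinuousMap.coeFn_toLp (dualHaar Λ) (evalChar l)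

theorem span_charLp_closure [Countable Λ] :
    (Submodule.span ℂ (Set.range (charLp (Λ := Λ) 2))).topologicalClosure = ⊤ := by
  convert! (ContinuousMap.toLp_denseRange ℂ (dualHaar Λ) ℂ
    (p := 2) ENNReal.ofNat_ne_top).topologicalClosure_map_submodule span_evalChar_closure
  rw [Submodule.map_span]
  unfold charLp
  rw [Set.range_comp']
  simp only [ContinuousLinearMap.coe_coe]

/-- Any nonzero element takes a value of infinite order at some character. -/
class SeparatedByDual (Λ : Type*) [AddCommGroup Λ] : Prop where
  exists_pow_ne_one : ∀ l : Λ, l ≠ 0 → ∃ x : Dual Λ, ∀ n : ℕ, 0 < n → x.1 l ^ n ≠ 1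

variable [SeparatedByDual Λ]

/-- Translating by a character `y` with `y(l) ≠ 1` multiplies the integral by `y(l)`, while Haar
measure is invariant. -/
theorem integral_evalChar {l : Λ} (hl : l ≠ 0) : ∫ x, evalChar l x ∂(dualHaar Λ) = 0 := by
  obtain ⟨y, hy⟩ := SeparatedByDual.exists_pow_ne_one l hl
  have h := integral_mul_left_eq_self (μ := dualHaar Λ) (fun x => evalChar l x) y
  have h1 : ∀ x, evalChar l (y * x) = (y.1 l : ℂ) * evalChar l x := fun x => by
    rw [evalChar_apply, evalChar_apply, ← Circle.coe_mul]
    rfl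
  simp only [h1] at h
  rw [integral_const_mul] at h
  by_contra h0
  have h2 : (y.1 l : ℂ) = 1 := by
    apply mul_right_cancel₀ h0
    rw [h, one_mul]
  refine hy 1 one_pos ?_
  rw [pow_one]
  exact Circle.ext h2

theorem orthonormal_charLp : Orthonormal ℂ (charLp (Λ := Λ) 2) := by
  classical
  rw [orthonormal_iff_ite]
  intro l s
  unfold charLp
  rw [ContinuousMap.inner_toLp (dualHaar Λ)]
  have h : ∀ x, evalChar s x * (starRingEnd ℂ) (evalChar l x) = evalChar (s - l) x := by
    intro x
    rw [sub_eq_add_neg, ← evalChar_mul, ← star_evalChar]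
    rfl
  simp only [h]
  split_ifs with hls
  · subst hls
    rw [sub_self, evalChar_zero]
    simp
  · exact integral_evalChar (sub_ne_zero.2 (Ne.symm hls))

variable (Λ) in
/-- The characters form a Hilbert basis of `L²` of the dual group. -/
def charBasis [Countable Λ] : HilbertBasis Λ ℂ (Lp ℂ 2 (dualHaar Λ)) :=
  HilbertBasis.mk orthonormal_charLp span_charLp_closure.ge

theorem charBasis_apply [Countable Λ] (l : Λ) : charBasis Λ l = charLp 2 l := by
  unfold charBasis
  rw [HilbertBasis.coe_mk]

/-- Translating by the powers of a `y` with `y(l)` of infinite order gives infinitely many disjoint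
fibers of equal measure in a probability space. Both non-atomicity and essential freeness rest on
this. -/
theorem measure_fiber_eq_zero {l : Λ} (hl : l ≠ 0) (z : Circle) :
    dualHaar Λ {x | x.1 l = z} = 0 := by
  obtain ⟨y, hy⟩ := SeparatedByDual.exists_pow_ne_one l hl
  have hm : ∀ w : Circle, MeasurableSet {x : Dual Λ | x.1 l = w} := fun w =>
    (isClosed_eq (continuous_dual_apply l) continuous_const).measurableSet
  have hinj : Function.Injective fun n : ℕ => y.1 l ^ n :=
    injective_pow_iff_not_isOfFinOrder.2 (by
      rw [isOfFinOrder_iff_pow_eq_one]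
      push Not
      exact hy)
  have hpre : ∀ n : ℕ, dualHaar Λ {x | x.1 l = y.1 l ^ n * z} = dualHaar Λ {x | x.1 l = z} := by
    intro n
    rw [← measure_preimage_mul (dualHaar Λ) (y ^ n) {x | x.1 l = y.1 l ^ n * z}]
    congr 1
    ext x
    change y.1 l ^ n * x.1 l = y.1 l ^ n * z ↔ x.1 l = z
    rw [mul_right_inj]
  by_contra h0
  have hsum : ∑' n : ℕ, dualHaar Λ {x | x.1 l = y.1 l ^ n * z} ≤ 1 := by
    rw [← measure_iUnion (fun n k hnk => ?_) (fun n => hm _)]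
    · exact prob_le_one
    · refine Set.disjoint_left.2 fun x hx hx' => hnk (hinj ?_)
      exact mul_right_cancel (Eq.trans (Eq.symm hx) hx')
  simp only [hpre] at hsum
  rw [ENNReal.tsum_const_eq_top_of_ne_zero h0] at hsum
  exact absurd hsum (by simp)

instance [Nontrivial Λ] : NullSingletonClass (dualHaar Λ) := ⟨fun x => by
  obtain ⟨l, hl⟩ := exists_ne (0 : Λ)
  refine measure_mono_null ?_ (measure_fiber_eq_zero hl (x.1 l))
  rintro _ rfl
  rfl⟩

end Dual

/-! ### Multiplication operators -/

section MulOp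

variable {X : Type*} [MeasurableSpace X] {ν : Measure X}

/-- The multiplication operator on `L²` of an essentially bounded function. -/
def mulOp (f : Lp ℂ ∞ ν) : Lp ℂ 2 ν →L[ℂ] Lp ℂ 2 ν :=
  (ContinuousLinearMap.mul ℂ ℂ).holderL ν ∞ 2 2 f

theorem coeFn_mulOp (f : Lp ℂ ∞ ν) (p : Lp ℂ 2 ν) : mulOp f p =ᵐ[ν] fun x => f x * p x :=
  (ContinuousLinearMap.mul ℂ ℂ).coeFn_holder f p

theorem mulOp_add (f g : Lp ℂ ∞ ν) : mulOp (f + g) = mulOp f + mulOp g :=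
  _root_.map_add _ f g

theorem mulOp_smul (z : ℂ) (f : Lp ℂ ∞ ν) : mulOp (z • f) = z • mulOp f :=
  map_smul _ z f

theorem mulOp_mul (f g : Lp ℂ ∞ ν) : mulOp (f * g) = mulOp f * mulOp g := by
  refine ContinuousLinearMap.ext fun p => Lp.ext ?_
  rw [mul_apply_eq_comp]
  filter_upwards [coeFn_mulOp (f * g) p, coeFn_mulOp f (mulOp g p), coeFn_mulOp g p,
    coeFn_Linfty_mul f g] with x h1 h2 h3 h4
  rw [h1, h2, h3, h4, mul_assoc]

theorem mulOp_star (f : Lp ℂ ∞ ν) : mulOp (star f) = star (mulOp f) := by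
  rw [ContinuousLinearMap.star_eq_adjoint, ContinuousLinearMap.eq_adjoint_iff]
  intro p q
  rw [L2.inner_def, L2.inner_def]
  refine integral_congr_ae ?_
  filter_upwards [coeFn_mulOp (star f) p, coeFn_mulOp f q, Lp.coeFn_star f] with x h1 h2 h3
  rw [h1, h2, h3, Pi.star_apply, RCLike.inner_apply, RCLike.inner_apply, map_mul,
    starRingEnd_apply, star_star]
  ring

theorem mulOp_comm (f g : Lp ℂ ∞ ν) : mulOp f * mulOp g = mulOp g * mulOp f := by
  refine ContinuousLinearMap.ext fun p => Lp.ext ?_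
  rw [mul_apply_eq_comp, mul_apply_eq_comp]
  filter_upwards [coeFn_mulOp g (mulOp f p), coeFn_mulOp f (mulOp g p), coeFn_mulOp g p,
    coeFn_mulOp f p] with x h1 h2 h3 h4
  rw [h1, h2, h3, h4]
  ring

/-- Testing on indicators gives `∫_s |h|² = ‖T 1_s‖² ≤ ‖T‖² ν(s)` for every measurable `s` of finite
measure. -/
theorem ae_norm_le_of_mul [SigmaFinite ν] {T : Lp ℂ 2 ν →L[ℂ] Lp ℂ 2 ν} {h : Lp ℂ 2 ν}
    (hT : ∀ p, T p =ᵐ[ν] fun x => p x * h x) : ∀ᵐ x ∂ν, ‖h x‖ ≤ ‖T‖ := by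
  have hpow : ∀ (p : Lp ℂ 2 ν), ENNReal.ofReal ‖p‖ ^ 2 = ∫⁻ x, ‖p x‖ₑ ^ 2 ∂ν := by
    intro p
    have h1 := eLpNorm_nnreal_pow_eq_lintegral (f := p) (p := 2) (μ := ν) two_ne_zero
    rw [ofReal_norm, Lp.enorm_def]
    simpa using h1
  have hle : (fun x => ‖h x‖ₑ ^ 2) ≤ᵐ[ν] fun _ => ENNReal.ofReal ‖T‖ ^ 2 := by
    refine ae_le_of_forall_setLIntegral_le_of_sigmaFinite
      ((Lp.stronglyMeasurable h).measurable.enorm.pow_const 2) fun s hs hνs => ?_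
    have hp := hT (indicatorConstLp 2 hs hνs.ne 1)
    have h1 : ∫⁻ x in s, ‖h x‖ₑ ^ 2 ∂ν =
        ENNReal.ofReal ‖T (indicatorConstLp 2 hs hνs.ne 1)‖ ^ 2 := by
      rw [hpow, ← lintegral_indicator hs]
      refine lintegral_congr_ae ?_
      filter_upwards [hp, indicatorConstLp_coeFn (p := 2) (hs := hs) (hμs := hνs.ne) (c := (1 : ℂ))]
        with x h1 h2
      rw [h1, h2]
      by_cases hx : x ∈ s <;> simp [hx]
    have h2 : ENNReal.ofReal ‖indicatorConstLp 2 hs hνs.ne (1 : ℂ)‖ ^ 2 = ν s := by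
      have h3 : ∫⁻ x, s.indicator 1 x ∂ν = ν s := lintegral_indicator_one hs
      rw [hpow]
      refine Eq.trans ?_ h3
      refine lintegral_congr_ae ?_
      filter_upwards [indicatorConstLp_coeFn (p := 2) (hs := hs) (hμs := hνs.ne) (c := (1 : ℂ))]
        with x h2
      rw [h2]
      by_cases hx : x ∈ s <;> simp [hx]
    rw [h1, setLIntegral_const]
    refine le_trans ?_ (mul_le_mul_right h2.le _)
    rw [← mul_pow, ← ENNReal.ofReal_mul (norm_nonneg _)]
    gcongr
    exact T.le_opNorm _
  filter_upwards [hle] with x hx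
  have hx' := (ENNReal.pow_le_pow_left_iff two_ne_zero).1 hx
  rw [← ofReal_norm] at hx'
  exact (ENNReal.ofReal_le_ofReal_iff (norm_nonneg _)).1 hx'

end MulOp

/-! ### The group von Neumann algebra as `L^∞` of the dual -/

section GroupAlgebra

variable {Λ : Type*} [AddCommGroup Λ] [Countable Λ] [SeparatedByDual Λ]

theorem mulOp_charLp (l s : Λ) : mulOp (charLp ∞ l) (charBasis Λ s) = charBasis Λ (l + s) := by
  rw [charBasis_apply, charBasis_apply]
  refine Lp.ext ?_
  filter_upwards [coeFn_mulOp (charLp ∞ l) (charLp 2 s), coeFn_charLp ∞ l, coeFn_charLp 2 s,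
    coeFn_charLp 2 (l + s)] with x h1 h2 h3 h4
  rw [h1, h2, h3, h4, dual_map_add, Circle.coe_mul]

theorem coeFn_charBasis_zero : charBasis Λ 0 =ᵐ[dualHaar Λ] fun _ => 1 := by
  rw [charBasis_apply]
  filter_upwards [coeFn_charLp 2 (0 : Λ)] with x hx
  rw [hx, dual_map_zero, Circle.coe_one]

/-- The multiplier must be `h = T 1`; boundedness of `T` forces `h` to be essentially bounded. -/
theorem exists_mulOp_eq {T : Lp ℂ 2 (dualHaar Λ) →L[ℂ] Lp ℂ 2 (dualHaar Λ)}
    (hT : ∀ l : Λ, mulOp (charLp ∞ l) * T = T * mulOp (charLp ∞ l)) : ∃ f, mulOp f = T := by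
  set h := T (charBasis Λ 0) with hh
  have hmul : ∀ p, T p =ᵐ[dualHaar Λ] fun x => p x * h x := by
    -- At this stage `h` is only in `L²`, so `p h` is only in `L¹`. The continuous maps `p ↦ T p ·
    -- 1` and `p ↦ p h` from `L²` to `L¹` are compared on the basis.
    let B := (ContinuousLinearMap.mul ℂ ℂ).holderL (dualHaar Λ) 2 2 1
    have hB : ∀ p q : Lp ℂ 2 (dualHaar Λ), B p q =ᵐ[dualHaar Λ] fun x => p x * q x :=
      fun p q => (ContinuousLinearMap.mul ℂ ℂ).coeFn_holder p q
    have heq : (B.flip (charBasis Λ 0)).comp T = B.flip h := by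
      refine ext_hilbertBasis (charBasis Λ) fun l => Lp.ext ?_
      have h1 : T (charBasis Λ l) = mulOp (charLp ∞ l) h := by
        have := DFunLike.congr_fun (hT l) (charBasis Λ 0)
        rw [mul_apply_eq_comp, mul_apply_eq_comp, mulOp_charLp, add_zero] at this
        exact this.symm
      rw [ContinuousLinearMap.comp_apply, ContinuousLinearMap.flip_apply,
        ContinuousLinearMap.flip_apply, h1]
      filter_upwards [hB (mulOp (charLp ∞ l) h) (charBasis Λ 0), hB (charBasis Λ l) h,
        coeFn_mulOp (charLp ∞ l) h, coeFn_charBasis_zero (Λ := Λ), coeFn_charLp ∞ l,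
        (charBasis_apply l).symm ▸ coeFn_charLp 2 l] with x h2 h3 h4 h5 h6 h7
      rw [h2, h3, h4, h5, h6, h7, mul_one]
    intro p
    have h1 := DFunLike.congr_fun heq p
    rw [ContinuousLinearMap.comp_apply, ContinuousLinearMap.flip_apply,
      ContinuousLinearMap.flip_apply] at h1
    have h2 := hB (T p) (charBasis Λ 0)
    rw [h1] at h2
    filter_upwards [h2, hB p h, coeFn_charBasis_zero (Λ := Λ)] with x h3 h4 h5
    rw [← h4, h3, h5, mul_one]
  have hbdd : MemLp h ∞ (dualHaar Λ) :=
    memLp_top_of_bound (Lp.aestronglyMeasurable h) ‖T‖ (ae_norm_le_of_mul hmul)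
  refine ⟨hbdd.toLp, ContinuousLinearMap.ext fun p => Lp.ext ?_⟩
  filter_upwards [coeFn_mulOp hbdd.toLp p, hmul p, hbdd.coeFn_toLp] with x h1 h2 h3
  rw [h1, h2, h3, mul_comm]

variable {K : Type*} [NormedAddCommGroup K] [InnerProductSpace ℂ K]
  (b : HilbertBasis Λ ℂ K) {v : Λ → K →L[ℂ] K}

/-- The Fourier transform from `L²` of the dual group. -/
def fourierIso : Lp ℂ 2 (dualHaar Λ) ≃ₗᵢ[ℂ] K := (charBasis Λ).repr.trans b.repr.symm

theorem fourierIso_charBasis (l : Λ) : fourierIso b (charBasis Λ l) = b l := by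
  classical
  rw [fourierIso, LinearIsometryEquiv.trans_apply, HilbertBasis.repr_self,
    HilbertBasis.repr_symm_single]

theorem fourierIso_symm_basis (l : Λ) : (fourierIso b).symm (b l) = charBasis Λ l := by
  rw [LinearIsometryEquiv.symm_apply_eq, fourierIso_charBasis]

variable [CompleteSpace K]

/-- Conjugation of operators by the Fourier transform. -/
def fourierConj :
    (Lp ℂ 2 (dualHaar Λ) →L[ℂ] Lp ℂ 2 (dualHaar Λ)) ≃⋆ₐ[ℂ] (K →L[ℂ] K) :=
  (fourierIso b).conjStarAlgEquiv

theorem fourierConj_apply (T : Lp ℂ 2 (dualHaar Λ) →L[ℂ] Lp ℂ 2 (dualHaar Λ)) (w : K) :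
    fourierConj b T w = fourierIso b (T ((fourierIso b).symm w)) := rfl

variable {b}

theorem fourierConj_mulOp_charLp (hv : IsTranslation b v) (l : Λ) :
    fourierConj b (mulOp (charLp ∞ l)) = v l :=
  ext_hilbertBasis b fun s => by
    rw [fourierConj_apply, fourierIso_symm_basis, mulOp_charLp, fourierIso_charBasis, hv]

theorem exists_fourierConj_mulOp_eq (hv : IsTranslation b v) {a : K →L[ℂ] K}
    (ha : ∀ l, v l * a = a * v l) : ∃ f, fourierConj b (mulOp f) = a := by
  obtain ⟨T, rfl⟩ : ∃ T, fourierConj b T = a :=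
    ⟨(fourierConj b).symm a, (fourierConj b).apply_symm_apply a⟩
  obtain ⟨f, rfl⟩ := exists_mulOp_eq (T := T) fun l => by
    refine EquivLike.injective (fourierConj b) ?_
    rw [map_mul, map_mul, fourierConj_mulOp_charLp hv, ha]
  exact ⟨f, rfl⟩

/-- Every element of the commutant is itself a multiplication operator, and these commute. -/
theorem fourierConj_mulOp_mem (hv : IsTranslation b v) (f : Lp ℂ ∞ (dualHaar Λ)) :
    fourierConj b (mulOp f) ∈ doubleCommutant (Set.range v) := by
  unfold doubleCommutant
  rw [StarSubalgebra.mem_centralizer_iff]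
  have key : ∀ a ∈ StarSubalgebra.centralizer ℂ (Set.range v),
      a * fourierConj b (mulOp f) = fourierConj b (mulOp f) * a := by
    intro a ha
    obtain ⟨g, rfl⟩ := exists_fourierConj_mulOp_eq hv (hv.mem_centralizer_iff.1 ha)
    rw [← map_mul, ← map_mul, mulOp_comm]
  exact fun a ha => ⟨key a ha, key _ (star_mem ha)⟩

theorem fourierConj_mulOp_injective (b : HilbertBasis Λ ℂ K) :
    Function.Injective fun f : Lp ℂ ∞ (dualHaar Λ) => fourierConj b (mulOp f) := by
  intro f g h
  have h1 := DFunLike.congr_fun ((fourierConj b).injective h) (charBasis Λ 0)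
  refine Lp.ext ?_
  have h2 := coeFn_mulOp f (charBasis Λ 0)
  rw [h1] at h2
  filter_upwards [h2, coeFn_mulOp g (charBasis Λ 0), coeFn_charBasis_zero (Λ := Λ)] with x h3 h4 h5
  rw [h5, mul_one] at h3 h4
  rw [← h3, h4]

/-- The double commutant of the translations is the algebra of essentially bounded functions on
the dual group. -/
def IsTranslation.gelfand (hv : IsTranslation b v) :
    Lp ℂ ∞ (dualHaar Λ) ≃⋆ₐ[ℂ] doubleCommutant (Set.range v) where
  toEquiv := Equiv.ofBijective
    (fun f => ⟨fourierConj b (mulOp f), fourierConj_mulOp_mem hv f⟩)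
    ⟨fun f g h => fourierConj_mulOp_injective b (congrArg Subtype.val h), fun a => by
      obtain ⟨f, hf⟩ := exists_fourierConj_mulOp_eq hv (hv.commute_of_mem a.2)
      exact ⟨f, Subtype.ext hf⟩⟩
  map_mul' f g := Subtype.ext (by
    change fourierConj b (mulOp (f * g)) = fourierConj b (mulOp f) * fourierConj b (mulOp g)
    rw [mulOp_mul, map_mul])
  map_add' f g := Subtype.ext (by
    change fourierConj b (mulOp (f + g)) = fourierConj b (mulOp f) + fourierConj b (mulOp g)
    rw [mulOp_add, _root_.map_add])
  map_star' f := Subtype.ext (by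
    change fourierConj b (mulOp (star f)) = star (fourierConj b (mulOp f))
    rw [mulOp_star, map_star])
  map_smul' z f := Subtype.ext (by
    change fourierConj b (mulOp (z • f)) = z • fourierConj b (mulOp f)
    rw [mulOp_smul, map_smul])

theorem IsTranslation.gelfand_charLp (hv : IsTranslation b v) (l : Λ) :
    hv.gelfand (charLp ∞ l) = hv.fourierExpansion.unit l :=
  Subtype.ext (fourierConj_mulOp_charLp hv l)

theorem IsTranslation.coef_gelfand (hv : IsTranslation b v) (f : Lp ℂ ∞ (dualHaar Λ)) (l : Λ) :
    hv.fourierExpansion.coef (hv.gelfand f) l =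
      ∫ x, f x * starRingEnd ℂ (x.1 l : ℂ) ∂(dualHaar Λ) := by
  change ⟪b l, fourierConj b (mulOp f) (b 0)⟫_ℂ = _
  rw [fourierConj_apply, fourierIso_symm_basis, ← fourierIso_charBasis b l,
    LinearIsometryEquiv.inner_map_map, L2.inner_def]
  refine integral_congr_ae ?_
  filter_upwards [coeFn_mulOp f (charBasis Λ 0), coeFn_charBasis_zero (Λ := Λ),
    (charBasis_apply l).symm ▸ coeFn_charLp 2 l] with x h1 h2 h3
  rw [h1, h2, h3, mul_one, RCLike.inner_apply]

end GroupAlgebra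

/-! ### Automorphisms of `L^∞` -/

section Automorphisms

variable {X : Type*} [MeasurableSpace X] {ν : Measure X}

theorem ae_norm_le_norm_Linfty (f : Lp ℂ ∞ ν) : ∀ᵐ x ∂ν, ‖f x‖ ≤ ‖f‖ := by
  have h := ae_le_eLpNormEssSup (f := f) (μ := ν)
  rw [← eLpNorm_exponent_top, ← Lp.enorm_def] at h
  filter_upwards [h] with x hx
  rwa [← ofReal_norm, ← ofReal_norm, ENNReal.ofReal_le_ofReal_iff (norm_nonneg _)] at hx

/-- With `h = √(C² - |f|²)` one has `|f|² + |h|² = C²`, an algebraic identity that `π` preserves.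
Here `e` is the constant function `1`. -/
theorem ae_norm_map_le {π : Lp ℂ ∞ ν ≃⋆ₐ[ℂ] Lp ℂ ∞ ν} {e : Lp ℂ ∞ ν} (he : ∀ᵐ x ∂ν, e x = 1)
    (hπ : π e = e) {f : Lp ℂ ∞ ν} {C : ℝ} (hf : ∀ᵐ x ∂ν, ‖f x‖ ≤ C) :
    ∀ᵐ x ∂ν, ‖π f x‖ ≤ C := by
  by_cases hC : 0 ≤ C
  swap
  · filter_upwards [hf] with x hx
    exact absurd ((norm_nonneg _).trans hx) hC
  have hm : AEStronglyMeasurable (fun x => ((√(C ^ 2 - ‖f x‖ ^ 2) : ℝ) : ℂ)) ν :=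
    (Complex.measurable_ofReal.comp (((Lp.stronglyMeasurable f).measurable.norm.pow_const
      2).const_sub (C ^ 2)).sqrt).aestronglyMeasurable
  have hh : MemLp (fun x => ((√(C ^ 2 - ‖f x‖ ^ 2) : ℝ) : ℂ)) ∞ ν := by
    refine memLp_top_of_bound hm C (Filter.Eventually.of_forall fun x => ?_)
    rw [Complex.norm_real, Real.norm_of_nonneg (Real.sqrt_nonneg _)]
    exact Real.sqrt_le_iff.2 ⟨hC, by nlinarith [sq_nonneg ‖f x‖]⟩
  have hsum : star f * f + star hh.toLp * hh.toLp = ((C ^ 2 : ℝ) : ℂ) • e := by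
    refine Lp.ext ?_
    filter_upwards [hf, he, hh.coeFn_toLp, Lp.coeFn_star f, Lp.coeFn_star hh.toLp,
      coeFn_Linfty_mul (star f) f, coeFn_Linfty_mul (star hh.toLp) hh.toLp,
      Lp.coeFn_add (star f * f) (star hh.toLp * hh.toLp), Lp.coeFn_smul ((C ^ 2 : ℝ) : ℂ) e]
      with x h1 h2 h3 h4 h5 h6 h7 h8 h9
    rw [h8, h9, Pi.add_apply, Pi.smul_apply, h2, h6, h7, h4, h5, Pi.star_apply, Pi.star_apply, h3,
      Complex.star_def, Complex.conj_mul', Complex.conj_ofReal,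
      ← Complex.ofReal_mul, Real.mul_self_sqrt, smul_eq_mul, mul_one]
    · push_cast
      ring
    · have := norm_nonneg (f x)
      nlinarith
  have hsum' := congrArg π hsum
  rw [map_add, map_mul, map_mul, map_star, map_star, map_smul, hπ] at hsum'
  filter_upwards [he, Lp.coeFn_star (π f), Lp.coeFn_star (π hh.toLp),
    coeFn_Linfty_mul (star (π f)) (π f), coeFn_Linfty_mul (star (π hh.toLp)) (π hh.toLp),
    Lp.coeFn_add (star (π f) * π f) (star (π hh.toLp) * π hh.toLp),
    Lp.coeFn_smul ((C ^ 2 : ℝ) : ℂ) e] with x h1 h2 h3 h4 h5 h6 h7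
  rw [hsum', h7, Pi.add_apply, Pi.smul_apply, h1, h4, h5, h2, h3, Pi.star_apply, Pi.star_apply,
    Complex.star_def, Complex.conj_mul', Complex.conj_mul', smul_eq_mul,
    mul_one] at h6
  have h8 : C ^ 2 = ‖π f x‖ ^ 2 + ‖π hh.toLp x‖ ^ 2 := by exact_mod_cast h6
  refine abs_le_of_sq_le_sq' ?_ hC |>.2
  nlinarith [sq_nonneg ‖π hh.toLp x‖]

variable [IsFiniteMeasure ν]

/-- The indicator function of a measurable set as an element of `L^∞`. -/
def indicatorLinfty (ν : Measure X) [IsFiniteMeasure ν] {s : Set X} (hs : MeasurableSet s) :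
    Lp ℂ ∞ ν := indicatorConstLp ∞ hs (measure_ne_top ν s) 1

theorem coeFn_indicatorLinfty {s : Set X} (hs : MeasurableSet s) :
    indicatorLinfty ν hs =ᵐ[ν] s.indicator fun _ => 1 := indicatorConstLp_coeFn

/-- Where `|f - z| ≤ 1/(n+1)`, the indicator cuts `f - z` down to a function with that bound; `π`
fixes the indicator and keeps the bound, so `π f` is equally close to `z`. Countably many pairs `(z,
n)` suffice. -/
theorem eq_of_map_indicator {π : Lp ℂ ∞ ν ≃⋆ₐ[ℂ] Lp ℂ ∞ ν} {e : Lp ℂ ∞ ν}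
    (he : ∀ᵐ x ∂ν, e x = 1) (hπ : π e = e)
    (hind : ∀ (s : Set X) (hs : MeasurableSet s),
      π (indicatorLinfty ν hs) = indicatorLinfty ν hs) (f : Lp ℂ ∞ ν) : π f = f := by
  have hfm : Measurable f := (Lp.stronglyMeasurable f).measurable
  obtain ⟨D, hDc, hD⟩ := TopologicalSpace.exists_countable_dense ℂ
  have key : ∀ z ∈ D, ∀ n : ℕ, ∀ᵐ x ∂ν, ‖f x - z‖ ≤ 1 / (n + 1) → ‖π f x - z‖ ≤ 1 / (n + 1) := by
    intro z _ n
    have hs : MeasurableSet {x | ‖f x - z‖ ≤ 1 / ((n : ℝ) + 1)} :=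
      measurableSet_le (hfm.sub_const z).norm measurable_const
    have hb : ∀ g : Lp ℂ ∞ ν, ∀ᵐ x ∂ν, (indicatorLinfty ν hs * (g - z • e)) x =
        Set.indicator {x | ‖f x - z‖ ≤ 1 / ((n : ℝ) + 1)} (fun x => g x - z) x := by
      intro g
      filter_upwards [he, coeFn_indicatorLinfty (ν := ν) hs,
        coeFn_Linfty_mul (indicatorLinfty ν hs) (g - z • e), Lp.coeFn_sub g (z • e),
        Lp.coeFn_smul z e] with x h1 h2 h3 h4 h5
      rw [h3, h2, h4, Pi.sub_apply, h5, Pi.smul_apply, h1, smul_eq_mul, mul_one]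
      by_cases hx : x ∈ {x | ‖f x - z‖ ≤ 1 / ((n : ℝ) + 1)}
      · rw [Set.indicator_of_mem hx, Set.indicator_of_mem hx, one_mul]
      · rw [Set.indicator_of_notMem hx, Set.indicator_of_notMem hx, zero_mul]
    have hle : ∀ᵐ x ∂ν, ‖(indicatorLinfty ν hs * (f - z • e)) x‖ ≤ 1 / ((n : ℝ) + 1) := by
      filter_upwards [hb f] with x hx
      rw [hx]
      by_cases h : x ∈ {x | ‖f x - z‖ ≤ 1 / ((n : ℝ) + 1)}
      · rw [Set.indicator_of_mem h]
        exact h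
      · rw [Set.indicator_of_notMem h, norm_zero]
        positivity
    have hmap : π (indicatorLinfty ν hs * (f - z • e)) = indicatorLinfty ν hs * (π f - z • e) := by
      rw [map_mul, hind, map_sub, map_smul, hπ]
    filter_upwards [ae_norm_map_le he hπ hle, hb (π f)] with x h1 h2 h3
    rw [hmap, h2, Set.indicator_of_mem (show x ∈ {x | ‖f x - z‖ ≤ 1 / ((n : ℝ) + 1)} from h3)] at h1
    exact h1
  have key' : ∀ᵐ x ∂ν, ∀ z ∈ D, ∀ n : ℕ,
      ‖f x - z‖ ≤ 1 / ((n : ℝ) + 1) → ‖π f x - z‖ ≤ 1 / ((n : ℝ) + 1) :=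
    (ae_ball_iff hDc).2 fun z hz => ae_all_iff.2 fun n => key z hz n
  refine Lp.ext ?_
  filter_upwards [key'] with x hx
  refine eq_of_forall_dist_le fun ε hε => ?_
  obtain ⟨n, hn⟩ := exists_nat_one_div_lt (half_pos hε)
  obtain ⟨z, hz, hzx⟩ := hD.exists_dist_lt (f x) (Nat.one_div_pos_of_nat (n := n) (α := ℝ))
  have h1 : ‖f x - z‖ ≤ 1 / ((n : ℝ) + 1) := by
    rw [← dist_eq_norm]
    exact hzx.le
  have h2 := hx z hz n h1
  rw [← dist_eq_norm] at h1 h2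
  rw [dist_comm] at h1
  linarith [dist_triangle (π f x) z (f x)]

variable [TopologicalSpace X] [BorelSpace X] [CompactSpace X] [HasOuterApproxClosed X]

/-- Continuous functions equal to `1` on `F` and tending to its indicator act as the identity on
`1_F`, hence on `π(1_F)`. In the limit `π(1_F)` vanishes off `F`. -/
theorem map_indicator_mul_of_isClosed {π : Lp ℂ ∞ ν ≃⋆ₐ[ℂ] Lp ℂ ∞ ν}
    (hπ : ∀ g : C(X, ℂ), π (ContinuousMap.toLp ∞ ν ℂ g) = ContinuousMap.toLp ∞ ν ℂ g)
    {F : Set X} (hF : IsClosed F) :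
    π (indicatorLinfty ν hF.measurableSet) * indicatorLinfty ν hF.measurableSet =
      π (indicatorLinfty ν hF.measurableSet) := by
  set s := indicatorLinfty ν hF.measurableSet with hs
  let g : ℕ → C(X, ℂ) := fun n => ⟨fun x => ((hF.apprSeq n x : ℝ) : ℂ), by fun_prop⟩
  have hg : ∀ n, ContinuousMap.toLp ∞ ν ℂ (g n) * s = s := by
    intro n
    refine Lp.ext ?_
    filter_upwards [coeFn_Linfty_mul (ContinuousMap.toLp ∞ ν ℂ (g n)) s,
      coeFn_indicatorLinfty (ν := ν) hF.measurableSet, ContinuousMap.coeFn_toLp (p := ∞) (𝕜 := ℂ) ν (g n)]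
      with x h1 h2 h3
    rw [h1, h2, h3]
    by_cases hx : x ∈ F
    · rw [Set.indicator_of_mem hx, mul_one]
      change ((hF.apprSeq n x : ℝ) : ℂ) = 1
      rw [HasOuterApproxClosed.apprSeq_apply_eq_one hF n hx]
      simp
    · rw [Set.indicator_of_notMem hx, mul_zero]
  have hae : ∀ᵐ x ∂ν, ∀ n, g n x * π s x = π s x := by
    refine ae_all_iff.2 fun n => ?_
    have h := congrArg π (hg n)
    rw [map_mul, hπ] at h
    filter_upwards [coeFn_Linfty_mul (ContinuousMap.toLp ∞ ν ℂ (g n)) (π s),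
      ContinuousMap.coeFn_toLp (p := ∞) (𝕜 := ℂ) ν (g n)] with x h1 h2
    rw [← h2, ← h1, h]
  refine Lp.ext ?_
  filter_upwards [hae, coeFn_Linfty_mul (π s) s,
    coeFn_indicatorLinfty (ν := ν) hF.measurableSet] with x h1 h2 h3
  rw [h2, h3]
  by_cases hx : x ∈ F
  · rw [Set.indicator_of_mem hx, mul_one]
  · rw [Set.indicator_of_notMem hx, mul_zero]
    have ht := tendsto_pi_nhds.1 (HasOuterApproxClosed.tendsto_apprSeq hF) x
    rw [Set.indicator_of_notMem hx] at ht
    have ht' : Filter.Tendsto (fun n => g n x * π s x) Filter.atTop (nhds (0 * π s x)) := by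
      refine Filter.Tendsto.mul_const _ ?_
      have hc : Continuous fun r : NNReal => ((r : ℝ) : ℂ) := by fun_prop
      have h4 := (hc.tendsto 0).comp ht
      rw [NNReal.coe_zero, Complex.ofReal_zero] at h4
      exact h4
    simp only [h1, zero_mul] at ht'
    exact tendsto_nhds_unique ht' tendsto_const_nhds

theorem map_indicator [ν.WeaklyRegular] {π : Lp ℂ ∞ ν ≃⋆ₐ[ℂ] Lp ℂ ∞ ν}
    (hπ : ∀ g : C(X, ℂ), π (ContinuousMap.toLp ∞ ν ℂ g) = ContinuousMap.toLp ∞ ν ℂ g)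
    (s : Set X) (hs : MeasurableSet s) : π (indicatorLinfty ν hs) = indicatorLinfty ν hs := by
  have hcomm : ∀ f g : Lp ℂ ∞ ν, f * g = g * f := by
    intro f g
    refine Lp.ext ?_
    filter_upwards [coeFn_Linfty_mul f g, coeFn_Linfty_mul g f] with x h1 h2
    rw [h1, h2, mul_comm]
  have hclosed : ∀ {F : Set X} (hF : IsClosed F),
      π (indicatorLinfty ν hF.measurableSet) = indicatorLinfty ν hF.measurableSet := by
    intro F hF
    have h1 := map_indicator_mul_of_isClosed hπ hF
    -- The same bound for the inverse of `π` gives the reverse inclusion.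
    have h2 := map_indicator_mul_of_isClosed (π := π.symm)
      (fun g => by rw [StarAlgEquiv.symm_apply_eq, hπ]) hF
    have h3 := congrArg π h2
    rw [map_mul, StarAlgEquiv.apply_symm_apply, hcomm, h1] at h3
    exact h3
  -- Inner approximation by closed sets shows `π(1_t) = 1` almost everywhere on `t`. Applied to `s`
  -- and its complement, whose indicators have product zero, this determines `π(1_s)`.
  have hone : ∀ (t : Set X) (ht : MeasurableSet t), ∀ᵐ x ∂ν, x ∈ t →
      π (indicatorLinfty ν ht) x = 1 := by
    intro t ht
    have hF : ∀ n : ℕ, ∃ F ⊆ t, IsClosed F ∧ ν (t \ F) < (n + 1 : ENNReal)⁻¹ := fun n =>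
      ht.exists_isClosed_sdiff_lt (measure_ne_top ν t) (by simp)
    choose F hFt hFc hFν using hF
    have hae : ∀ᵐ x ∂ν, ∀ n, x ∈ F n → π (indicatorLinfty ν ht) x = 1 := by
      refine ae_all_iff.2 fun n => ?_
      have hmul : indicatorLinfty ν (hFc n).measurableSet * indicatorLinfty ν ht =
          indicatorLinfty ν (hFc n).measurableSet := by
        refine Lp.ext ?_
        filter_upwards [coeFn_Linfty_mul (indicatorLinfty ν (hFc n).measurableSet)
          (indicatorLinfty ν ht), coeFn_indicatorLinfty (ν := ν) (hFc n).measurableSet,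
          coeFn_indicatorLinfty (ν := ν) ht] with x h1 h2 h3
        rw [h1, h2, h3]
        by_cases hx : x ∈ F n
        · rw [Set.indicator_of_mem hx, Set.indicator_of_mem (hFt n hx), mul_one]
        · rw [Set.indicator_of_notMem hx, zero_mul]
      have hmul' := congrArg π hmul
      rw [map_mul, hclosed (hFc n)] at hmul'
      filter_upwards [coeFn_Linfty_mul (indicatorLinfty ν (hFc n).measurableSet)
        (π (indicatorLinfty ν ht)), coeFn_indicatorLinfty (ν := ν) (hFc n).measurableSet]
        with x h1 h2 h3
      rw [hmul', h2, Set.indicator_of_mem h3, one_mul] at h1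
      exact h1.symm
    have hnull : ν (t \ ⋃ n, F n) = 0 := by
      refine le_antisymm (ge_of_tendsto' (x := Filter.atTop) (f := fun n : ℕ =>
        ((n : ENNReal) + 1)⁻¹) ?_ fun n => ?_) zero_le
      · have := (Filter.tendsto_add_atTop_iff_nat 1).2 ENNReal.tendsto_inv_nat_nhds_zero
        simpa using this
      · exact (measure_mono (Set.sdiff_subset_sdiff_right (Set.subset_iUnion F n))).trans (hFν n).le
    have hnull' : ∀ᵐ x ∂ν, x ∉ t \ ⋃ n, F n := measure_eq_zero_iff_ae_notMem.1 hnull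
    filter_upwards [hae, hnull'] with x h1 h2 h3
    obtain ⟨n, hn⟩ : ∃ n, x ∈ F n := by
      by_contra h
      exact h2 ⟨h3, fun h' => h (Set.mem_iUnion.1 h')⟩
    exact h1 n hn
  have hzero : indicatorLinfty ν hs * indicatorLinfty ν hs.compl = 0 := by
    refine Lp.ext ?_
    filter_upwards [coeFn_Linfty_mul (indicatorLinfty ν hs) (indicatorLinfty ν hs.compl),
      coeFn_indicatorLinfty (ν := ν) hs, coeFn_indicatorLinfty (ν := ν) hs.compl,
      Lp.coeFn_zero ℂ ∞ ν] with x h1 h2 h3 h4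
    rw [h1, h2, h3, h4]
    by_cases hx : x ∈ s <;> simp [hx]
  have hzero' := congrArg π hzero
  rw [map_mul, map_zero] at hzero'
  refine Lp.ext ?_
  filter_upwards [hone s hs, hone sᶜ hs.compl, coeFn_indicatorLinfty (ν := ν) hs,
    coeFn_Linfty_mul (π (indicatorLinfty ν hs)) (π (indicatorLinfty ν hs.compl)),
    Lp.coeFn_zero ℂ ∞ ν] with x h1 h2 h3 h4 h5
  rw [h3]
  by_cases hx : x ∈ s
  · rw [h1 hx, Set.indicator_of_mem hx]
  · rw [hzero', h5, h2 hx, mul_one] at h4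
    rw [Set.indicator_of_notMem hx, ← h4, Pi.zero_apply]

end Automorphisms

/-! ### Automorphisms fixing the characters -/

section DualAutomorphisms

variable {Λ : Type*} [AddCommGroup Λ] [Countable Λ]

/-- An automorphism of `L^∞` of the dual group that fixes the characters is trivial. -/
theorem eq_refl_of_map_charLp {π : Lp ℂ ∞ (dualHaar Λ) ≃⋆ₐ[ℂ] Lp ℂ ∞ (dualHaar Λ)}
    (hπ : ∀ l : Λ, π (charLp ∞ l) = charLp ∞ l) (f : Lp ℂ ∞ (dualHaar Λ)) : π f = f := by
  have he : ∀ᵐ x ∂(dualHaar Λ), charLp ∞ (0 : Λ) x = 1 := by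
    filter_upwards [coeFn_charLp ∞ (0 : Λ)] with x hx
    rw [hx, dual_map_zero, Circle.coe_one]
  let _ := TopologicalSpace.upgradeIsCompletelyMetrizable (Dual Λ)
  let πL : Lp ℂ ∞ (dualHaar Λ) →ₗ[ℂ] Lp ℂ ∞ (dualHaar Λ) :=
    { toFun := π, map_add' := map_add π, map_smul' := map_smul π }
  -- A `*`-automorphism is contractive, so fixing trigonometric polynomials extends to their uniform
  -- limits, the continuous functions.
  let πC : Lp ℂ ∞ (dualHaar Λ) →L[ℂ] Lp ℂ ∞ (dualHaar Λ) :=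
    πL.mkContinuous 1 fun f => by
      rw [one_mul]
      exact (Lp.norm_le_of_ae_bound (norm_nonneg f)
        (ae_norm_map_le he (hπ 0) (ae_norm_le_norm_Linfty f))).trans_eq (by simp)
  have hC : ∀ g : C(Dual Λ, ℂ), π (ContinuousMap.toLp ∞ (dualHaar Λ) ℂ g) =
      ContinuousMap.toLp ∞ (dualHaar Λ) ℂ g := by
    have heq : πC.comp (ContinuousMap.toLp ∞ (dualHaar Λ) ℂ) =
        ContinuousMap.toLp ∞ (dualHaar Λ) ℂ :=
      ContinuousLinearMap.ext_on
        (Submodule.dense_iff_topologicalClosure_eq_top.2 span_evalChar_closure) (by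
          rintro _ ⟨l, rfl⟩
          exact hπ l)
    exact fun g => DFunLike.congr_fun heq g
  exact eq_of_map_indicator he (hπ 0) (map_indicator hC) f

end DualAutomorphisms

/-! ### The dual action of `ℤ² ⋊ SL(2,ℤ)` -/

section DualAction

instance : Countable (Lam ℤ) := by
  unfold Lam
  infer_instance

theorem exists_apply_ne_zero {l : Lam ℤ} (hl : l ≠ 0) : ∃ m, l.1 m ≠ 0 := by
  by_contra! h
  exact hl (Subtype.ext (Finsupp.ext h))

/-- Otherwise `n = 2πk` for an integer `k ≠ 0`, and `π` would be rational. -/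
theorem circle_exp_one_pow_ne_one (n : ℕ) (hn : 0 < n) : Circle.exp 1 ^ n ≠ 1 := by
  intro h
  have h1 : Circle.exp (n : ℝ) = 1 := by
    rw [← h, ← Circle.exp_natCast_mul, mul_one]
  obtain ⟨k, hk⟩ := Circle.exp_eq_one.1 h1
  have hk0 : (k : ℝ) ≠ 0 := by
    rintro h0
    rw [h0, zero_mul] at hk
    exact hn.ne' (by exact_mod_cast hk)
  refine irrational_pi ⟨n / (2 * k), ?_⟩
  push_cast
  rw [hk]
  field_simp

instance : SeparatedByDual (Lam ℤ) := ⟨fun l hl => by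
  obtain ⟨m, hm⟩ := exists_apply_ne_zero hl
  refine ⟨⟨fun s => Circle.exp 1 ^ s.1 m, fun s t => zpow_add _ (s.1 m) (t.1 m)⟩, fun n hn h => ?_⟩
  change (Circle.exp 1 ^ l.1 m) ^ n = 1 at h
  refine circle_exp_one_pow_ne_one ((l.1 m).natAbs * n) (Nat.mul_pos (Int.natAbs_pos.2 hm) hn) ?_
  rw [pow_mul]
  rcases Int.natAbs_eq (l.1 m) with h' | h'
  · rwa [h', zpow_natCast] at h
  · rwa [h', zpow_neg, zpow_natCast, inv_pow, inv_eq_one] at h⟩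

theorem exists_smul_ne {g : Gam} (hg : g ≠ 1) : ∃ l : Lam ℤ, g • l ≠ l := by
  obtain ⟨m, hm⟩ : ∃ m : Z2, g • m ≠ m := by
    by_contra! h
    apply hg
    have hk : g.left.toAdd = 0 := by
      have := h 0
      rwa [smul_def, Matrix.mulVec_zero, add_zero] at this
    have hγ : ∀ m : Z2, Matrix.mulVec g.right m = m := by
      intro m
      have := h m
      rwa [smul_def, hk, zero_add] at this
    refine SemidirectProduct.ext ?_ ?_
    · exact Multiplicative.toAdd.injective hk
    · apply Subtype.ext
      refine Matrix.ext_of_mulVec_single fun i => ?_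
      rw [hγ]
      exact (Matrix.one_mulVec _).symm
  obtain ⟨m', hm'⟩ := exists_ne m
  -- At `g • m` the translated edge has value `1`, whereas the edge itself is at most `0` there.
  refine ⟨edge m' m, fun h => ?_⟩
  have h1 := DFunLike.congr_fun (congrArg Subtype.val h) (g • m)
  rw [smul_edge, edge_apply, edge_apply, if_pos rfl, if_neg (fun h' => hm' (smul_left_cancel g h')),
    if_neg (Ne.symm hm)] at h1
  split_ifs at h1 <;> lia

instance : Nontrivial (Lam ℤ) := by
  have h : affine e₁ 1 ≠ 1 := fun h => by
    have := congrFun (congrArg (fun g : Gam => g.left.toAdd) h) 0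
    simp [affine] at this
  obtain ⟨l, hl⟩ := exists_smul_ne h
  exact ⟨_, _, hl⟩

theorem twist_one (χ : AddChar ℤ Circle) (l : Lam ℤ) : twist χ 1 l = 1 := by
  have h := twist_mul χ 1 1 l
  rw [mul_one, one_smul] at h
  exact mul_eq_left.1 h.symm

/-- The action of a group element on the dual of `Λ(ℤ)` by `x ↦ (λ ↦ twist(g, λ) x(g λ))`. -/
def dualMap (c : Circle) (g : Gam) (x : Dual (Lam ℤ)) : Dual (Lam ℤ) :=
  ⟨fun l => twist (charZ c) g l * x.1 (g • l), fun l s => by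
    beta_reduce
    rw [twist_add, lam_smul_add, dual_map_add, mul_mul_mul_comm]⟩

theorem dualMap_apply (c : Circle) (g : Gam) (x : Dual (Lam ℤ)) (l : Lam ℤ) :
    (dualMap c g x).1 l = twist (charZ c) g l * x.1 (g • l) := rfl

/-- Precomposition reverses the order, so this is a right action; `dualEquiv` therefore uses `g⁻¹`.
-/
theorem dualMap_dualMap (c : Circle) (g h : Gam) (x : Dual (Lam ℤ)) :
    dualMap c g (dualMap c h x) = dualMap c (h * g) x := by
  refine Subtype.ext (funext fun l => ?_)
  rw [dualMap_apply, dualMap_apply, dualMap_apply, twist_mul, mul_smul, ← mul_assoc,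
    mul_comm (twist _ g l)]

theorem dualMap_one (c : Circle) (x : Dual (Lam ℤ)) : dualMap c 1 x = x := by
  refine Subtype.ext (funext fun l => ?_)
  rw [dualMap_apply, twist_one, one_smul, one_mul]

theorem continuous_dualMap (c : Circle) (g : Gam) : Continuous (dualMap c g) :=
  Continuous.subtype_mk (continuous_pi fun l =>
    continuous_const.mul (continuous_dual_apply (g • l))) _

/-- The automorphism `x ↦ (λ ↦ x(g λ))` of the dual of `Λ(ℤ)`. -/
def dualPrecomp (g : Gam) : Dual (Lam ℤ) →* Dual (Lam ℤ) where
  toFun x := ⟨fun l => x.1 (g • l), fun l s => by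
    beta_reduce
    rw [lam_smul_add, dual_map_add]⟩
  map_one' := rfl
  map_mul' _ _ := rfl

theorem measurePreserving_dualMap (c : Circle) (g : Gam) :
    MeasurePreserving (dualMap c g) (dualHaar (Lam ℤ)) (dualHaar (Lam ℤ)) := by
  have h1 : MeasurePreserving (dualPrecomp g) (dualHaar (Lam ℤ)) (dualHaar (Lam ℤ)) := by
    refine MonoidHom.measurePreserving ?_ ?_ rfl
    · exact Continuous.subtype_mk (continuous_pi fun l => continuous_dual_apply (g • l)) _
    · intro x
      refine ⟨dualPrecomp g⁻¹ x, Subtype.ext (funext fun l => ?_)⟩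
      change x.1 (g⁻¹ • g • l) = x.1 l
      rw [inv_smul_smul]
  -- The twist is itself a character of `Λ(ℤ)`, so multiplying by it is a translation of the dual.
  have h2 := measurePreserving_mul_left (dualHaar (Lam ℤ))
    (⟨twist (charZ c) g, twist_add (charZ c) g⟩ : Dual (Lam ℤ))
  exact h2.comp h1

/-- The action of `ℤ² ⋊ SL(2,ℤ)` on the dual of `Λ(ℤ)` by Borel isomorphisms. -/
def dualEquiv (c : Circle) (g : Gam) : Dual (Lam ℤ) ≃ᵐ Dual (Lam ℤ) where
  toFun := dualMap c g⁻¹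
  invFun := dualMap c g
  left_inv x := by rw [dualMap_dualMap, inv_mul_cancel, dualMap_one]
  right_inv x := by rw [dualMap_dualMap, mul_inv_cancel, dualMap_one]
  measurable_toFun := (continuous_dualMap c g⁻¹).measurable
  measurable_invFun := (continuous_dualMap c g).measurable

theorem measure_fixedPoints_dualEquiv (c : Circle) {g : Gam} (hg : g ≠ 1) :
    dualHaar (Lam ℤ) {x | dualEquiv c g x = x} = 0 := by
  obtain ⟨l, hl⟩ := exists_smul_ne (inv_ne_one.2 hg)
  refine measure_mono_null ?_
    (measure_fiber_eq_zero (sub_ne_zero.2 hl) (twist (charZ c) g⁻¹ l)⁻¹)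
  intro x hx
  have h1 : twist (charZ c) g⁻¹ l * x.1 (g⁻¹ • l) = x.1 l :=
    congrFun (congrArg Subtype.val hx) l
  change x.1 (g⁻¹ • l - l) = _
  rw [sub_eq_add_neg, dual_map_add, dual_map_neg, ← h1, mul_inv, mul_comm, mul_assoc,
    inv_mul_cancel, mul_one]

end DualAction

/-! ### The action carried over to the dual group -/

section TransportedAction

variable {K : Type*} [NormedAddCommGroup K] [InnerProductSpace ℂ K] [CompleteSpace K]
  {b : HilbertBasis (Lam ℤ) ℂ K} {v : Lam ℤ → K →L[ℂ] K} (hv : IsTranslation b v)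
  {c d : Circle} {β β' : Gam →* (doubleCommutant (Set.range v) ≃⋆ₐ[ℂ] doubleCommutant (Set.range v))}

theorem IsTranslation.coef_zero_eq_integral (a : doubleCommutant (Set.range v)) :
    hv.fourierExpansion.coef a 0 = ∫ x, hv.gelfand.symm a x ∂(dualHaar (Lam ℤ)) := by
  have h := hv.coef_gelfand (hv.gelfand.symm a) 0
  rw [StarAlgEquiv.apply_symm_apply] at h
  rw [h]
  refine integral_congr_ae (Filter.Eventually.of_forall fun x => ?_)
  simp only [dual_map_zero, Circle.coe_one, map_one, mul_one]

/-- Both sides have the same Fourier coefficients: after the measure preserving change of variables,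
the twist cancels against its conjugate. -/
theorem transport_gelfand_apply (hβ : hv.fourierExpansion.IsCovariant c fun g a => β g a)
    (g : Gam) (f : Lp ℂ ∞ (dualHaar (Lam ℤ))) :
    transport hv.gelfand.symm β g f =ᵐ[dualHaar (Lam ℤ)] fun x => f (dualMap c g x) := by
  have hS := measurePreserving_dualMap c g
  have hcoe := Lp.coeFn_compMeasurePreserving f hS
  suffices transport hv.gelfand.symm β g f = Lp.compMeasurePreserving (dualMap c g) hS f by
    rw [this]
    exact hcoe
  change hv.gelfand.symm (β g (hv.gelfand f)) = _
  rw [StarAlgEquiv.symm_apply_eq]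
  apply hv.fourierExpansion.coef_injective
  ext l
  rw [← smul_inv_smul g l]
  set s := g⁻¹ • l
  have h1 : hv.fourierExpansion.coef (β g (hv.gelfand f)) (g • s) = _ := hβ g (hv.gelfand f) s
  rw [h1, hv.coef_gelfand, hv.coef_gelfand,
    ← hS.integral_comp (dualEquiv c g).symm.measurableEmbedding, ← integral_const_mul]
  refine integral_congr_ae ?_
  filter_upwards [hcoe] with x hx
  rw [hx, dualMap_apply, Circle.coe_mul, map_mul, Function.comp_apply, ← Circle.coe_inv_eq_conj,
    Circle.coe_inv]
  field_simp [Circle.coe_ne_zero]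

theorem transport_gelfand_isTracePreserving
    (hβ : hv.fourierExpansion.IsCovariant c fun g a => β g a) :
    IsTracePreserving (transport hv.gelfand.symm β) := by
  intro g f
  rw [integral_congr_ae (transport_gelfand_apply hv hβ g f)]
  exact (measurePreserving_dualMap c g).integral_comp (dualEquiv c g).symm.measurableEmbedding _

theorem transport_gelfand_isEssentiallyFree
    (hβ : hv.fourierExpansion.IsCovariant c fun g a => β g a) :
    IsEssentiallyFree (transport hv.gelfand.symm β) := by
  refine ⟨dualEquiv c, fun g h x => ?_, fun g => measurePreserving_dualMap c g⁻¹,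
    fun g f => transport_gelfand_apply hv hβ g f, fun g hg => measure_fixedPoints_dualEquiv c hg⟩
  change dualMap c (g * h)⁻¹ x = dualMap c g⁻¹ (dualMap c h⁻¹ x)
  rw [dualMap_dualMap, mul_inv_rev]

theorem transport_gelfand_isErgodic
    (hβ : hv.fourierExpansion.IsCovariant c fun g a => β g a) :
    IsErgodic (transport hv.gelfand.symm β) := by
  intro f hf
  obtain ⟨z, hz⟩ := hβ.ergodic (a := hv.gelfand f) fun g => by
    have : hv.gelfand.symm (β g (hv.gelfand f)) = f := hf g
    rwa [StarAlgEquiv.symm_apply_eq] at this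
  refine ⟨z, ?_⟩
  rw [← hv.fourierExpansion.unit_zero, ← hv.gelfand_charLp, ← map_smul,
    (EquivLike.injective hv.gelfand).eq_iff] at hz
  rw [hz]
  filter_upwards [Lp.coeFn_smul z (charLp ∞ (0 : Lam ℤ)), coeFn_charLp ∞ (0 : Lam ℤ)] with x h1 h2
  rw [h1, Pi.smul_apply, h2, dual_map_zero, Circle.coe_one, smul_eq_mul, mul_one]

theorem transport_gelfand_rigid (hc : c ∈ params) (hd : d ∈ params)
    (hβ : hv.fourierExpansion.IsCovariant c fun g a => β g a)
    (hβ' : hv.fourierExpansion.IsCovariant d fun g a => β' g a)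
    {π : Lp ℂ ∞ (dualHaar (Lam ℤ)) ≃⋆ₐ[ℂ] Lp ℂ ∞ (dualHaar (Lam ℤ))}
    (hπ : ∀ g f, π (transport hv.gelfand.symm β g f) = transport hv.gelfand.symm β' g (π f)) :
    c = d ∧ ∀ f, π f = f := by
  let ρ : doubleCommutant (Set.range v) ≃⋆ₐ[ℂ] doubleCommutant (Set.range v) :=
    (hv.gelfand.symm.trans π).trans hv.gelfand
  have hρ : ∀ g a, ρ (β g a) = β' g (ρ a) := by
    intro g a
    have h := hπ g (hv.gelfand.symm a)
    change π (hv.gelfand.symm (β g (hv.gelfand (hv.gelfand.symm a)))) =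
      hv.gelfand.symm (β' g (hv.gelfand (π (hv.gelfand.symm a)))) at h
    rw [StarAlgEquiv.apply_symm_apply] at h
    change hv.gelfand (π (hv.gelfand.symm (β g a))) = β' g (hv.gelfand (π (hv.gelfand.symm a)))
    rw [h, StarAlgEquiv.apply_symm_apply]
  obtain ⟨hcd, hfix⟩ := FourierExpansion.rigidity (F := hv.fourierExpansion)
    (βc := fun g a => β g a) (βd := fun g a => β' g a) (π := ρ.toAlgEquiv)
    hβ hβ' (fun g z a => map_smul (β' g) z a) hρ hc hd
  refine ⟨hcd, eq_refl_of_map_charLp fun l => ?_⟩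
  have h : hv.gelfand (π (hv.gelfand.symm (hv.fourierExpansion.unit l))) =
    hv.fourierExpansion.unit l := hfix l
  have h0 : hv.gelfand.symm (hv.fourierExpansion.unit l) = charLp ∞ l := by
    rw [StarAlgEquiv.symm_apply_eq]
    exact (hv.gelfand_charLp l).symm
  rw [h0] at h
  exact EquivLike.injective hv.gelfand (h.trans (hv.gelfand_charLp l).symm)

end TransportedAction

/-! ### The group von Neumann algebra `N(ℤ, 1)` -/

section GroupVonNeumannAlgebra

/-- The standard orthonormal basis of `ℓ²`. -/
def ellTwoBasis (ι : Type*) : HilbertBasis ι ℂ (EllTwo ι) :=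
  HilbertBasis.ofRepr (LinearIsometryEquiv.refl ℂ (EllTwo ι))

theorem ellTwoBasis_apply {ι : Type*} (i : ι) : ellTwoBasis ι i = basisVec i := rfl

theorem inner_ellTwoBasis {ι : Type*} (i : ι) (w : EllTwo ι) : ⟪ellTwoBasis ι i, w⟫_ℂ = w i :=
  ((ellTwoBasis ι).repr_apply_apply w i).symm

theorem weightedUnitary_basisVec {ι : Type*} (e : ι ≃ ι) (w : ι → Circle) (i : ι) :
    (weightedUnitary e w : EllTwo ι →L[ℂ] EllTwo ι) (basisVec i) = (w i : ℂ) • basisVec (e i) := by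
  classical
  refine lp.ext (funext fun j => ?_)
  rw [weightedUnitary_apply, lp.coeFn_smul, Pi.smul_apply, basisVec_apply, basisVec_apply,
    smul_eq_mul]
  by_cases h : j = e i
  · subst h
    simp
  · rw [if_neg h, if_neg (fun h' => h (e.symm_apply_eq.1 h')), mul_zero, mul_zero]

theorem tildeCocycle_one (l s : Lam ℤ) : tildeCocycle 1 l s = 1 := finprod_one

/-- The unitaries `u(λ)` as operators. -/
def unitaries (l : Lam ℤ) : EllTwo (Lam ℤ) →L[ℂ] EllTwo (Lam ℤ) := (u 1 l).1

theorem isTranslation_unitaries : IsTranslation (ellTwoBasis (Lam ℤ)) unitaries := by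
  intro l s
  rw [ellTwoBasis_apply, ellTwoBasis_apply, unitaries, u, weightedUnitary_basisVec,
    tildeCocycle_one, Circle.coe_one, one_smul]
  rfl

theorem coe_conjAction {R G : Type*} [Ring R] [StarRing R] [Algebra ℂ R] [StarModule ℂ R] [Group G]
    (S : Set R) (V : G →* unitary R)
    (hV : ∀ g, ∀ s ∈ S, ∃ t ∈ S, ∃ z : ℂ, z ≠ 0 ∧ Unitary.conjStarAlgAut ℂ R (V g) t = z • s)
    (g : G) (a : doubleCommutant S) :
    (conjAction S V hV g a : R) = V g * a * star (V g : R) := rfl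

/-- The twisted Bernoulli shift as an action on the double commutant of the unitaries. -/
def shiftAction (c : Circle) :
    Gam →* (doubleCommutant (Set.range unitaries) ≃⋆ₐ[ℂ] doubleCommutant (Set.range unitaries)) :=
  twistedBernoulli 1 (charZ c)

theorem coe_shiftAction (c : Circle) (g : Gam) (a : doubleCommutant (Set.range unitaries)) :
    (shiftAction c g a : EllTwo (Lam ℤ) →L[ℂ] EllTwo (Lam ℤ)) =
      implementing (charZ c) g * a.1 * star (implementing (charZ c) g).1 := by
  unfold shiftAction twistedBernoulli
  exact coe_conjAction _ _ _ g a

theorem implementing_star_basis_zero (c : Circle) (g : Gam) :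
    star (implementing (charZ c) g : EllTwo (Lam ℤ) →L[ℂ] EllTwo (Lam ℤ))
      (ellTwoBasis (Lam ℤ) 0) = ellTwoBasis (Lam ℤ) 0 := by
  have h : (implementing (charZ c) g : EllTwo (Lam ℤ) →L[ℂ] EllTwo (Lam ℤ))
      (ellTwoBasis (Lam ℤ) 0) = ellTwoBasis (Lam ℤ) 0 := by
    have h1 := weightedUnitary_basisVec (MulAction.toPerm g) (twist (charZ c) g) (0 : Lam ℤ)
    have h2 : g • (0 : Lam ℤ) = 0 := by
      refine Subtype.ext (Finsupp.ext fun m => ?_)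
      rw [lam_smul_apply]
      rfl
    rw [twist_zero, Circle.coe_one, one_smul, MulAction.toPerm_apply, h2] at h1
    exact h1
  have h3 := DFunLike.congr_fun (Unitary.star_mul_self_of_mem (implementing (charZ c) g).2)
    (ellTwoBasis (Lam ℤ) 0)
  rw [mul_apply_eq_comp, h] at h3
  exact h3

/-- The implementing unitaries fix `δ₀`, so the action on `a δ₀`, which carries the Fourier
coefficients of `a`, is the unitary itself. -/
theorem shiftAction_basis_zero (c : Circle) (g : Gam)
    (a : doubleCommutant (Set.range unitaries)) :
    (shiftAction c g a : EllTwo (Lam ℤ) →L[ℂ] EllTwo (Lam ℤ)) (ellTwoBasis (Lam ℤ) 0) =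
      (weightedUnitary (MulAction.toPerm g) (twist (charZ c) g) :
        EllTwo (Lam ℤ) →L[ℂ] EllTwo (Lam ℤ)) (a.1 (ellTwoBasis (Lam ℤ) 0)) := by
  rw [coe_shiftAction, mul_apply_eq_comp, mul_apply_eq_comp, implementing_star_basis_zero]
  rfl

theorem isCovariant_shiftAction (c : Circle) :
    isTranslation_unitaries.fourierExpansion.IsCovariant c fun g a => shiftAction c g a := by
  intro g a l
  have h := weightedUnitary_apply (MulAction.toPerm g) (twist (charZ c) g)
    (a.1 (ellTwoBasis (Lam ℤ) 0)) (g • l)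
  rw [MulAction.toPerm_symm_apply, inv_smul_smul, ← shiftAction_basis_zero] at h
  have h1 := inner_ellTwoBasis (g • l)
    ((shiftAction c g a : EllTwo (Lam ℤ) →L[ℂ] EllTwo (Lam ℤ)) (ellTwoBasis (Lam ℤ) 0))
  have h2 := inner_ellTwoBasis l (a.1 (ellTwoBasis (Lam ℤ) 0))
  exact h1.trans (h.trans (congrArg (fun z => (twist (charZ c) g l : ℂ) * z) h2.symm))

/-- The isomorphism of `N(ℤ, 1)` with the algebra of essentially bounded functions on the dual of
`Λ(ℤ)`. -/
def gelfandIso : NAlg (1 : NormalizedCocycle ℤ) ≃⋆ₐ[ℂ] Lp ℂ ∞ (dualHaar (Lam ℤ)) :=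
  isTranslation_unitaries.gelfand.symm

/-- The twisted Bernoulli shift as an action on the essentially bounded functions on the dual of
`Λ(ℤ)`. -/
def linftyAction (c : Circle) :
    Gam →* (Lp ℂ ∞ (dualHaar (Lam ℤ)) ≃⋆ₐ[ℂ] Lp ℂ ∞ (dualHaar (Lam ℤ))) :=
  transport isTranslation_unitaries.gelfand.symm (shiftAction c)

theorem linftyAction_eq (c : Circle) :
    linftyAction c = transport gelfandIso (twistedBernoulli 1 (charZ c)) := rfl

theorem linftyAction_rigid {c d : Circle} (hc : c ∈ params) (hd : d ∈ params)
    {π : Lp ℂ ∞ (dualHaar (Lam ℤ)) ≃⋆ₐ[ℂ] Lp ℂ ∞ (dualHaar (Lam ℤ))}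
    (hπ : ∀ g f, π (linftyAction c g f) = linftyAction d g (π f)) : c = d ∧ ∀ f, π f = f :=
  transport_gelfand_rigid isTranslation_unitaries hc hd (isCovariant_shiftAction c)
    (isCovariant_shiftAction d) hπ

theorem linftyAction_centralizer {c : Circle} (hc : c ∈ params) :
    actionCentralizer (linftyAction c) = ⊥ := by
  refine (Subgroup.eq_bot_iff_forall _).2 fun α hα =>
    StarAlgEquiv.ext (linftyAction_rigid hc hc fun g f => ?_).2
  have h := Subgroup.mem_centralizer_iff.1 hα _ ⟨g, rfl⟩
  exact (DFunLike.congr_fun h f).symm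

theorem trace_eq_integral (a : NAlg (1 : NormalizedCocycle ℤ)) :
    trace 1 a = ∫ x, gelfandIso a x ∂(dualHaar (Lam ℤ)) :=
  isTranslation_unitaries.coef_zero_eq_integral a

end GroupVonNeumannAlgebra

theorem mk_params : Cardinal.mk params = Cardinal.continuum := by
  unfold params
  rw [Cardinal.mk_image_eq_of_injOn, Cardinal.mk_Ioo_real (by norm_num)]
  intro s hs t ht hst
  have h := Real.pi_pos
  have hs' := Circle.arg_exp (x := Real.pi * s) (by nlinarith [hs.1]) (by nlinarith [hs.2])
  have ht' := Circle.arg_exp (x := Real.pi * t) (by nlinarith [ht.1]) (by nlinarith [ht.2])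
  have hst' : Circle.exp (Real.pi * s) = Circle.exp (Real.pi * t) := hst
  rw [hst', ht'] at hs'
  exact mul_left_cancel₀ h.ne' hs'.symm

end TwistedBernoulli

end

theorem corollary5p4 :
    ∃ (X : Type) (_ : MeasurableSpace X) (_ : StandardBorelSpace X) (ν : Measure X)
      (_ : IsProbabilityMeasure ν) (_ : NullSingletonClass ν)
      (Φ : TwistedBernoulli.NAlg (1 : TwistedBernoulli.NormalizedCocycle ℤ) ≃⋆ₐ[ℂ] Lp ℂ ∞ ν)
      (β : Circle → (TwistedBernoulli.Gam →* (Lp ℂ ∞ ν ≃⋆ₐ[ℂ] Lp ℂ ∞ ν))),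
      (∀ a, TwistedBernoulli.trace 1 a = ∫ x, Φ a x ∂ν) ∧
      (∀ c, β c = TwistedBernoulli.transport Φ
        (TwistedBernoulli.twistedBernoulli 1 (TwistedBernoulli.charZ c))) ∧
      Cardinal.mk TwistedBernoulli.params = Cardinal.continuum ∧
      (∀ c ∈ TwistedBernoulli.params,
        TwistedBernoulli.IsTracePreserving (β c) ∧
        TwistedBernoulli.IsEssentiallyFree (β c) ∧
        TwistedBernoulli.IsErgodic (β c) ∧
        TwistedBernoulli.actionCentralizer (β c) = ⊥) ∧
      (∀ c ∈ TwistedBernoulli.params, ∀ d ∈ TwistedBernoulli.params, c ≠ d →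
        ¬ TwistedBernoulli.AreConjugate (β c) (β d)) := by
  refine ⟨TwistedBernoulli.Dual (TwistedBernoulli.Lam ℤ), inferInstance, inferInstance,
    TwistedBernoulli.dualHaar _, inferInstance, inferInstance, TwistedBernoulli.gelfandIso,
    TwistedBernoulli.linftyAction, TwistedBernoulli.trace_eq_integral,
    TwistedBernoulli.linftyAction_eq, TwistedBernoulli.mk_params, fun c hc => ?_,
    fun c hc d hd hcd => ?_⟩
  · have hβ := TwistedBernoulli.isCovariant_shiftAction c
    exact ⟨TwistedBernoulli.transport_gelfand_isTracePreserving _ hβ,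
      TwistedBernoulli.transport_gelfand_isEssentiallyFree _ hβ,
      TwistedBernoulli.transport_gelfand_isErgodic _ hβ,
      TwistedBernoulli.linftyAction_centralizer hc⟩
  · rintro ⟨π, hπ⟩
    exact hcd (TwistedBernoulli.linftyAction_rigid hc hd hπ).1
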